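/- Let $H$ be a complex Hilbert space, let $\mathcal N\subset B(H)$ be a von Neumann algebra with a faithful normal semifinite trace $\tau$, and write $\tau$ also for its linear extension to $\mathcal L_1(\mathcal N,\tau)$. For $A\in\mathcal N$ and $t\ge 0$ put $\mu(t,A)=\inf\{\|Ap\| : p\in\mathcal N \text{ a projection},\ \tau(1-p)\le t\}$, and let $$\mathcal M_{1,\infty}=\Big\{A\in\mathcal N:\ \sup_{t>0}\frac1{\log(1+t)}\int_0^t\mu(s,A)\,ds<\infty\Big\}.$$ Let $L_\infty(0,\infty)$ be the space of bounded Lebesgue measurable real functions on $(0,\infty)$. A generalised limit is a positive linear functional $\gamma:L_\infty(0,\infty)\to\mathbb R$ with $\gamma(1)=1$ and $\gamma(z)=0$ whenever $\lim_{t\to\infty}z(t)=0$. If $x$ is a real function on $(0,\infty)$ that is measurable and bounded on $[1,\infty)$, but possibly not near $0$, we write $\gamma(x)$ for $\gamma(x\chi_{[1,\infty)})$; this agrees with the original value if $x\in L_\infty(0,\infty)$, and the cut-off point $1$ may be replaced by any larger one. We extend $\gamma$ to complex functions by complex linearity. For $B\in\mathcal N$ and a positive operator $A\in\mathcal M_{1,\infty}$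 set $$\zeta_\gamma(A)=\gamma\Big(\frac1t\tau(A^{1+1/t})\Big),\qquad \zeta_{\gamma,B}(A)=\gamma\Big(\frac1t\tau(A^{1+1/t}B)\Big),$$ and for an arbitrary $A\in\mathcal M_{1,\infty}$ set $$\zeta_\gamma(A)=\zeta_\gamma((\Re A)_+)-\zeta_\gamma((\Re A)_-)+i\big(\zeta_\gamma((\Im A)_+)-\zeta_\gamma((\Im A)_-)\big),$$ where $X_+$ and $X_-$ are the positive operators with $X=X_+-X_-$ and $X_+X_-=0$ for a self-adjoint $X$, and define $\zeta_{\gamma,B}(A)$ in the same way. Then for every generalised limit $\gamma$, every $A\in\mathcal M_{1,\infty}$ and every $B\in\mathcal N$, one has $AB\in\mathcal M_{1,\infty}$, both $\zeta_{\gamma,B}(A)$ and $\zeta_\gamma(AB)$ are well defined (all the traces involved are finite, and the functions to which $\gamma$ is applied are measurable and bounded on $[1,\infty)$), and $$\zeta_{\gamma,B}(A)=\zeta_\gamma(AB).$$ -/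

import Mathlib

open scoped ENNReal ComplexStarModule

/-! ### Bounded measurable functions on the half-line and generalised limits -/

/-- The space of all bounded Lebesgue measurable real functions on `(0, ∞)`.
Functions are not identified almost everywhere; a functional on almost everywhere classes is
the same as a functional on this space that vanishes on the null functions, so statements about
all functionals on this space cover both conventions. -/
def LInfty : Submodule ℝ (Set.Ioi (0 : ℝ) → ℝ) where
  carrier := {x | AEMeasurable x (MeasureTheory.volume.comap Subtype.val) ∧ ∃ C : ℝ, ∀ t, |x t| ≤ C}
  add_mem' := by
    rintro x y ⟨hx, C, hC⟩ ⟨hy, D, hD⟩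
    exact ⟨hx.add hy, C + D, fun t => (abs_add_le _ _).trans (add_le_add (hC t) (hD t))⟩
  zero_mem' := ⟨aemeasurable_const, 0, fun t => by simp⟩
  smul_mem' := by
    rintro c x ⟨hx, C, hC⟩
    refine ⟨hx.const_smul c, |c| * C, fun t => ?_⟩
    simpa [abs_mul] using mul_le_mul_of_nonneg_left (hC t) (abs_nonneg c)

/-- The constant function `1` is bounded and measurable. -/
theorem one_mem_LInfty : (1 : Set.Ioi (0 : ℝ) → ℝ) ∈ LInfty :=
  ⟨aemeasurable_const, 1, fun t => by simp⟩

/-- A generalised limit: a positive normalised linear functional on `L_∞(0, ∞)` that vanishes on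
every function with limit `0` at infinity. -/
structure GeneralisedLimit where
  toLinearMap : LInfty →ₗ[ℝ] ℝ
  nonneg' : ∀ x : LInfty, (∀ t, 0 ≤ x.1 t) → 0 ≤ toLinearMap x
  map_one' : toLinearMap ⟨1, one_mem_LInfty⟩ = 1
  vanish' : ∀ x : LInfty,
    (∀ ε : ℝ, 0 < ε → ∃ T : ℝ, ∀ t : Set.Ioi (0 : ℝ), T ≤ t → |x.1 t| ≤ ε) → toLinearMap x = 0

/-- The function `x · χ_{[1, ∞)}`. -/
noncomputable def tailPart (x : Set.Ioi (0 : ℝ) → ℝ) : Set.Ioi (0 : ℝ) → ℝ :=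
  Set.indicator {t | (1 : ℝ) ≤ t} x

open Classical in
/-- The value `γ(x)` of a generalised limit at a function `x` on `(0, ∞)` that is bounded and
measurable on `[1, ∞)` but possibly unbounded near `0`, as `t ↦ t⁻¹ τ(A ^ (1 + 1/t))` is in
general. For `x ∈ L_∞(0, ∞)` it is the original value, and the cut-off point `1` is immaterial,
because `γ` vanishes on the bounded functions that are `0` near infinity. (The default `0` is only
used for functions that are not bounded and measurable on `[1, ∞)`.) -/
noncomputable def GeneralisedLimit.eval (γ : GeneralisedLimit) (x : Set.Ioi (0 : ℝ) → ℝ) : ℝ :=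
  if h : tailPart x ∈ LInfty then γ.toLinearMap ⟨tailPart x, h⟩ else 0

/-- The complex-linear extension of a generalised limit to complex-valued functions. -/
noncomputable def GeneralisedLimit.evalC (γ : GeneralisedLimit)
    (x : Set.Ioi (0 : ℝ) → ℂ) : ℂ :=
  (γ.eval fun t => (x t).re) + Complex.I * (γ.eval fun t => (x t).im)

section Operators

variable {H : Type*} [NormedAddCommGroup H] [InnerProductSpace ℂ H] [CompleteSpace H]

/-! ### The Jordan decomposition -/

/-- The extension to all bounded operators, through
`A = ((Re A)₊ - (Re A)₋) + i ((Im A)₊ - (Im A)₋)`, of a function `F` given on positive operators.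
All four parts are positive operators. -/
noncomputable def jordanExtend (F : (H →L[ℂ] H) → ℂ) (A : H →L[ℂ] H) : ℂ :=
  (F ((ℜ A : H →L[ℂ] H)⁺) - F ((ℜ A : H →L[ℂ] H)⁻)) +
    Complex.I * (F ((ℑ A : H →L[ℂ] H)⁺) - F ((ℑ A : H →L[ℂ] H)⁻))

/-- All four positive parts of `A` have the property `p`. -/
def JordanForall (p : (H →L[ℂ] H) → Prop) (A : H →L[ℂ] H) : Prop :=
  p ((ℜ A : H →L[ℂ] H)⁺) ∧ p ((ℜ A : H →L[ℂ] H)⁻) ∧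
    p ((ℑ A : H →L[ℂ] H)⁺) ∧ p ((ℑ A : H →L[ℂ] H)⁻)

/-! ### Traces on a von Neumann algebra -/

/-- A faithful normal semifinite trace on the von Neumann algebra `N`. It is a `[0, ∞]`-valued
function on the positive cone of `N`; its values elsewhere carry no information and are never
used. The order is the usual order of operators. -/
structure FNSTrace (N : VonNeumannAlgebra H) where
  toFun : (H →L[ℂ] H) → ℝ≥0∞
  map_add' : ∀ A ∈ N, ∀ B ∈ N, 0 ≤ A → 0 ≤ B → toFun (A + B) = toFun A + toFun B
  map_smul' : ∀ c : ℝ, 0 ≤ c → ∀ A ∈ N, 0 ≤ A → toFun (c • A) = ENNReal.ofReal c * toFun A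
  tracial' : ∀ X ∈ N, toFun (star X * X) = toFun (X * star X)
  faithful' : ∀ A ∈ N, 0 ≤ A → toFun A = 0 → A = 0
  normal' : ∀ S : Set (H →L[ℂ] H), (∀ A ∈ S, A ∈ N ∧ 0 ≤ A) → S.Nonempty →
    DirectedOn (· ≤ ·) S → ∀ A ∈ N, IsLUB S A → toFun A = ⨆ X ∈ S, toFun X
  semifinite' : ∀ A ∈ N, 0 ≤ A → A ≠ 0 → ∃ X ∈ N, 0 ≤ X ∧ X ≤ A ∧ X ≠ 0 ∧ toFun X < ∞

namespace FNSTrace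

variable {N : VonNeumannAlgebra H} (τ : FNSTrace N)

/-- `X` is in the domain `L₁(N, τ)` of the extended trace. -/
def Finite (X : H →L[ℂ] H) : Prop :=
  JordanForall (fun P => τ.toFun P < ∞) X

/-- The linear extension of the trace to `L₁(N, τ)`. -/
noncomputable def ext (X : H →L[ℂ] H) : ℂ :=
  jordanExtend (fun P => ((τ.toFun P).toReal : ℂ)) X

/-- The generalised singular value function
`μ(t, A) = inf {‖A p‖ : p a projection in N, τ(1 - p) ≤ t}`. -/
noncomputable def mu (t : ℝ) (A : H →L[ℂ] H) : ℝ :=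
  sInf {r : ℝ | ∃ p ∈ N, IsStarProjection p ∧ τ.toFun (1 - p) ≤ ENNReal.ofReal t ∧ r = ‖A * p‖}

/-- The Marcinkiewicz operator space `M_{1,∞}(N, τ)`: all `A ∈ N` with
`sup_{t > 0} (log (1 + t))⁻¹ ∫₀ᵗ μ(s, A) ds < ∞`. -/
def M1Infty : Set (H →L[ℂ] H) :=
  {A | A ∈ N ∧ ∃ C : ℝ, ∀ t : ℝ, 0 < t →
    1 / Real.log (1 + t) * (∫ s in (0 : ℝ)..t, τ.mu s A) ≤ C}

/-! ### Zeta functions and zeta functionals -/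

/-- The function `t ↦ t⁻¹ τ(P ^ (1 + 1/t))` for positive `P`. -/
noncomputable def zetaFun (P : H →L[ℂ] H) (t : Set.Ioi (0 : ℝ)) : ℝ :=
  1 / (t : ℝ) * (τ.toFun (P ^ (1 + 1 / (t : ℝ)))).toReal

/-- The function `t ↦ t⁻¹ τ(P ^ (1 + 1/t) B)` for positive `P`. -/
noncomputable def zetaFunTwisted (B P : H →L[ℂ] H) (t : Set.Ioi (0 : ℝ)) : ℂ :=
  1 / ((t : ℝ) : ℂ) * τ.ext (P ^ (1 + 1 / (t : ℝ)) * B)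

/-- The functional `ζ_γ`, given by `γ(t⁻¹ τ(A ^ (1 + 1/t)))` on positive operators and extended
through the Jordan decomposition. -/
noncomputable def zeta (γ : GeneralisedLimit) (A : H →L[ℂ] H) : ℂ :=
  jordanExtend (fun P => (γ.eval (τ.zetaFun P) : ℂ)) A

/-- The functional `ζ_{γ,B}`, given by `γ(t⁻¹ τ(A ^ (1 + 1/t) B))` on positive operators and
extended through the Jordan decomposition. -/
noncomputable def zetaTwisted (γ : GeneralisedLimit) (B A : H →L[ℂ] H) : ℂ :=
  jordanExtend (fun P => γ.evalC (τ.zetaFunTwisted B P)) A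

/-- `ζ_γ(A)` is well defined for every generalised limit `γ`: the traces involved are finite, and
the zeta functions are bounded and measurable on `[1, ∞)`. -/
def ZetaDefined (A : H →L[ℂ] H) : Prop :=
  JordanForall (fun P =>
    (∀ t : Set.Ioi (0 : ℝ), τ.toFun (P ^ (1 + 1 / (t : ℝ))) < ∞) ∧
      tailPart (τ.zetaFun P) ∈ LInfty) A

/-- `ζ_{γ,B}(A)` is well defined for every generalised limit `γ`. -/
def ZetaTwistedDefined (B A : H →L[ℂ] H) : Prop :=
  JordanForall (fun P =>
    (∀ t : Set.Ioi (0 : ℝ), τ.Finite (P ^ (1 + 1 / (t : ℝ)) * B)) ∧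
      tailPart (fun t => (τ.zetaFunTwisted B P t).re) ∈ LInfty ∧
      tailPart (fun t => (τ.zetaFunTwisted B P t).im) ∈ LInfty) A

end FNSTrace

end Operators

/-!
On positive operators `ζ_γ` is additive, because it is sub- and superadditive up to factors
`2^{1/t}`, which `γ` does not see, and it takes the same value on `X*X` and `XX*`. It therefore
extends to a tracial linear functional on the span of the *logarithmic cone*
`{P ≥ 0 : τ((P - 2^{-k})₊) = O(k + 1)}`, which contains the four positive parts of every `A` in
`M_{1,∞}`. For `P` in the cone and `0 ≤ b ≤ n`, operator monotonicity of `x ↦ x^{1/t}` gives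
`ζ_γ(P^{1/2} b P^{1/2}) ≤ γ(t⁻¹ τ(P^{1+1/t} b))` up to a factor `n^{1/t}`; the inequalities for `b`
and for `n - b` add up to the equality `n ζ_γ(P) = n ζ_γ(P)`, so both are equalities. Since the
extension is tracial, `ζ_γ(P^{1/2} b P^{1/2}) = ζ_γ(Pb)`, and linearity in `b` and in `P` gives the
theorem.
-/

section Commutant

variable {H : Type*} [NormedAddCommGroup H] [InnerProductSpace ℂ H] [CompleteSpace H]
  {N : VonNeumannAlgebra H} {a b : H →L[ℂ] H}

theorem mem_vonNeumann_of_forall_commute (ha : a ∈ N) (h : ∀ g, Commute a g → Commute b g) :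
    b ∈ N := by
  rw [← VonNeumannAlgebra.commutant_commutant N, VonNeumannAlgebra.mem_commutant_iff]
  exact fun g hg => (h g (VonNeumannAlgebra.mem_commutant_iff.1 hg a ha)).eq.symm

theorem cfc_mem_vonNeumann (ha : a ∈ N) (f : ℝ → ℝ) : cfc f a ∈ N :=
  mem_vonNeumann_of_forall_commute ha fun _ h => h.cfc_real f

theorem rpow_mem_vonNeumann (ha : a ∈ N) (s : ℝ) : a ^ s ∈ N :=
  mem_vonNeumann_of_forall_commute ha fun _ h => h.cfc_nnreal _

theorem sqrt_mem_vonNeumann (ha : a ∈ N) : CFC.sqrt a ∈ N :=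
  mem_vonNeumann_of_forall_commute ha fun _ h => h.cfcₙ_nnreal _

theorem abs_mem_vonNeumann (ha : a ∈ N) : CFC.abs a ∈ N :=
  sqrt_mem_vonNeumann (mul_mem (star_mem ha) ha)

theorem posPart_mem_vonNeumann (ha : a ∈ N) : a⁺ ∈ N :=
  mem_vonNeumann_of_forall_commute ha fun _ h => h.cfcₙ_real _

theorem negPart_mem_vonNeumann (ha : a ∈ N) : a⁻ ∈ N :=
  mem_vonNeumann_of_forall_commute ha fun _ h => h.cfcₙ_real _

theorem complex_smul_mem_vonNeumann (c : ℂ) (ha : a ∈ N) : c • a ∈ N :=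
  N.toStarSubalgebra.smul_mem ha c

theorem real_smul_mem_vonNeumann (c : ℝ) (ha : a ∈ N) : c • a ∈ N := by
  rw [← Complex.coe_smul]
  exact complex_smul_mem_vonNeumann _ ha

theorem algebraMap_real_mem_vonNeumann (c : ℝ) : algebraMap ℝ (H →L[ℂ] H) c ∈ N := by
  rw [Algebra.algebraMap_eq_smul_one]
  exact real_smul_mem_vonNeumann _ (one_mem N)

theorem realPart_mem_vonNeumann (ha : a ∈ N) : (ℜ a : H →L[ℂ] H) ∈ N := by
  rw [realPart_apply_coe]
  exact real_smul_mem_vonNeumann _ (add_mem ha (star_mem ha))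

theorem imaginaryPart_mem_vonNeumann (ha : a ∈ N) : (ℑ a : H →L[ℂ] H) ∈ N := by
  rw [imaginaryPart_apply_coe]
  exact complex_smul_mem_vonNeumann _ (real_smul_mem_vonNeumann _ (sub_mem ha (star_mem ha)))

end Commutant

section FunctionalCalculus

theorem semiconjBy_cfcHomSuperset {A : Type*} [Ring A] [StarRing A] [TopologicalSpace A]
    [ContinuousMul A] [T2Space A] [Algebra ℝ A]
    [ContinuousFunctionalCalculus ℝ A IsSelfAdjoint] {x a b : A} (ha : IsSelfAdjoint a)
    (hb : IsSelfAdjoint b) (h : SemiconjBy x a b) {s : Set ℝ} [CompactSpace s]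
    (hsa : spectrum ℝ a ⊆ s) (hsb : spectrum ℝ b ⊆ s) (g : C(s, ℝ)) :
    SemiconjBy x (cfcHomSuperset ha hsa g) (cfcHomSuperset hb hsb g) := by
  induction g using ContinuousMap.induction_on_of_compact with
  | const r =>
    rw [show ContinuousMap.const s r = algebraMap ℝ C(s, ℝ) r from rfl, AlgHomClass.commutes,
      AlgHomClass.commutes]
    exact (Algebra.commutes r x).symm
  | id => rwa [cfcHomSuperset_id, cfcHomSuperset_id]
  | star_id =>
    rwa [map_star, map_star, cfcHomSuperset_id, cfcHomSuperset_id, ha.star_eq, hb.star_eq]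
  | add f g hf hg => rw [map_add, map_add]; exact hf.add_right hg
  | mul f g hf hg => rw [map_mul, map_mul]; exact hf.mul_right hg
  | frequently f hf =>
    have hc : IsClosed {g : C(s, ℝ) |
        SemiconjBy x (cfcHomSuperset ha hsa g) (cfcHomSuperset hb hsb g)} :=
      isClosed_eq (continuous_const.mul (cfcHomSuperset_continuous ha hsa))
        ((cfcHomSuperset_continuous hb hsb).mul continuous_const)
    exact hc.closure_subset (mem_closure_of_frequently_of_tendsto hf Filter.tendsto_id)

theorem semiconjBy_cfc {A : Type*} [Ring A] [StarRing A] [TopologicalSpace A]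
    [ContinuousMul A] [T2Space A] [Algebra ℝ A]
    [ContinuousFunctionalCalculus ℝ A IsSelfAdjoint] {x a b : A} (ha : IsSelfAdjoint a)
    (hb : IsSelfAdjoint b) (h : SemiconjBy x a b) {f : ℝ → ℝ}
    (hf : ContinuousOn f (spectrum ℝ a ∪ spectrum ℝ b)) :
    SemiconjBy x (cfc f a) (cfc f b) := by
  have : CompactSpace ↥(spectrum ℝ a ∪ spectrum ℝ b) := isCompact_iff_compactSpace.1
    ((ContinuousFunctionalCalculus.isCompact_spectrum a).union
      (ContinuousFunctionalCalculus.isCompact_spectrum b))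
  rw [cfc_apply f a ha (hf.mono Set.subset_union_left),
    cfc_apply f b hb (hf.mono Set.subset_union_right)]
  exact semiconjBy_cfcHomSuperset ha hb h Set.subset_union_left Set.subset_union_right
    ⟨_, hf.domRestrict⟩

variable {A : Type*} [CStarAlgebra A]

theorem mul_cfc_star_mul_self_mul_star (x : A) {g : ℝ → ℝ} (hg : Continuous g) :
    x * cfc g (star x * x) * star x = cfc (fun r => r * g r) (x * star x) := by
  have h : SemiconjBy x (cfc g (star x * x)) (cfc g (x * star x)) :=
    semiconjBy_cfc (.star_mul_self x) (.mul_star_self x) (mul_assoc x (star x) x).symm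
      hg.continuousOn
  rw [h.eq, mul_assoc, cfc_mul (fun r : ℝ => r) g _ continuousOn_id hg.continuousOn,
    (cfc_commute_cfc (fun r : ℝ => r) g (x * star x)).eq,
    cfc_id' ℝ (x * star x) (.mul_star_self x)]

theorem posPart_sub_algebraMap_eq_cfc {a : A} (ha : IsSelfAdjoint a) (c : ℝ) :
    (a - algebraMap ℝ A c)⁺ = cfc (fun x : ℝ => max (x - c) 0) a := by
  have h_shift : a - algebraMap ℝ A c = cfc (fun x : ℝ => x - c) a := by
    rw [cfc_sub (fun x : ℝ => x) (fun _ => c) a, cfc_id' .., cfc_const ..]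
  rw [CFC.posPart_def, cfcₙ_eq_cfc, h_shift, ← cfc_comp' (fun x : ℝ => x⁺) (fun x : ℝ => x - c) a]
  rfl

variable [PartialOrder A] [StarOrderedRing A]

theorem rpow_mul_rpow_of_pos {a : A} {x y : ℝ} (hx : 0 < x) (hy : 0 < y) :
    a ^ x * a ^ y = a ^ (x + y) := by
  lift x to NNReal using hx.le
  lift y to NNReal using hy.le
  rw [NNReal.coe_pos] at hx hy
  rw [← NNReal.coe_add, ← CFC.nnrpow_eq_rpow hx, ← CFC.nnrpow_eq_rpow hy,
    ← CFC.nnrpow_eq_rpow (add_pos hx hy), CFC.nnrpow_add hx hy]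

theorem sqrt_rpow_of_nonneg {a : A} {x : ℝ} (hx : 0 ≤ x) : CFC.sqrt (a ^ x) = a ^ (x / 2) := by
  lift x to NNReal using hx
  exact CFC.sqrt_rpow_nnreal

theorem smul_rpow_of_nonneg {a : A} (ha : 0 ≤ a) {c p : ℝ} (hc : 0 ≤ c) (hp : 0 ≤ p) :
    (c • a) ^ p = c ^ p • a ^ p := by
  have hcont : Continuous fun x : ℝ => x ^ p := Real.continuous_rpow_const hp
  rw [CFC.rpow_eq_cfc_real (smul_nonneg hc ha), CFC.rpow_eq_cfc_real ha,
    ← cfc_comp_smul c (fun x : ℝ => x ^ p) a hcont.continuousOn,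
    ← cfc_const_mul (c ^ p) (fun x : ℝ => x ^ p) a hcont.continuousOn]
  exact cfc_congr fun x hx => Real.mul_rpow hc (spectrum_nonneg_of_nonneg ha hx)

theorem rpow_le_smul_rpow {a : A} (ha : 0 ≤ a) {c p q : ℝ} (hac : a ≤ algebraMap ℝ A c)
    (hp : 0 < p) (hpq : p ≤ q) : a ^ q ≤ c ^ (q - p) • a ^ p := by
  have hcont {r : ℝ} (hr : 0 < r) : Continuous fun x : ℝ => x ^ r :=
    Real.continuous_rpow_const hr.le
  rw [CFC.rpow_eq_cfc_real ha, CFC.rpow_eq_cfc_real ha,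
    ← cfc_const_mul _ _ a (hcont hp).continuousOn]
  refine cfc_mono (fun x hx => ?_) (hcont (hp.trans_le hpq)).continuousOn
    ((hcont hp).const_mul _).continuousOn
  have hx0 : 0 ≤ x := spectrum_nonneg_of_nonneg ha hx
  have hxc : x ≤ c := (le_algebraMap_iff_spectrum_le (a := a)).1 hac x hx
  calc x ^ q = x ^ (q - p) * x ^ p := by
        rw [← Real.rpow_add_of_nonneg hx0 (sub_nonneg.2 hpq) hp.le, sub_add_cancel]
    _ ≤ c ^ (q - p) * x ^ p := by
        gcongr

theorem sqrt_conj_nonneg (a : A) {b : A} (hb : 0 ≤ b) : 0 ≤ CFC.sqrt a * b * CFC.sqrt a := by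
  simpa only [(CFC.sqrt_nonneg a).isSelfAdjoint.star_eq] using
    star_left_conjugate_nonneg hb (CFC.sqrt a)

theorem sqrt_conj_mono (a : A) {b c : A} (hbc : b ≤ c) :
    CFC.sqrt a * b * CFC.sqrt a ≤ CFC.sqrt a * c * CFC.sqrt a := by
  simpa only [(CFC.sqrt_nonneg a).isSelfAdjoint.star_eq] using
    star_left_conjugate_le_conjugate hbc (CFC.sqrt a)

theorem cfc_rpowIntegrand₁₂_eq {a : A} (ha : 0 ≤ a) {t : ℝ} (ht : 0 < t) (p : ℝ) :
    cfc (Real.rpowIntegrand₁₂ p t) a =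
      (t ^ (p - 1) * t⁻¹) • a + ((t ^ (p - 1) * t) • Ring.inverse (algebraMap ℝ A t + a) -
        algebraMap ℝ A (t ^ (p - 1))) := by
  have hne : ∀ r ∈ spectrum ℝ a, t + r ≠ 0 := by grind
  have hinv : ContinuousOn (fun r : ℝ => (t + r)⁻¹) (spectrum ℝ a) := by
    fun_prop (disch := grind -abstractProof)
  have h_inverse : cfc (fun r : ℝ => (t + r)⁻¹) a = Ring.inverse (algebraMap ℝ A t + a) := by
    rw [cfc_inv _ _ hne .., cfc_const_add .., cfc_id' ..]
  have h_integrand : Real.rpowIntegrand₁₂ p t = fun r =>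
      (t ^ (p - 1) * t⁻¹) * r + ((t ^ (p - 1) * t) * (t + r)⁻¹ - t ^ (p - 1)) := by
    ext r
    rw [Real.rpowIntegrand₁₂]
    ring
  generalize t ^ (p - 1) * t⁻¹ = c at h_integrand ⊢
  generalize t ^ (p - 1) * t = d at h_integrand ⊢
  generalize t ^ (p - 1) = e at h_integrand ⊢
  have hd : ContinuousOn (fun r : ℝ => d * (t + r)⁻¹) (spectrum ℝ a) := hinv.const_smul d
  rw [h_integrand, cfc_add (a := a) (fun r : ℝ => c * r) (fun r : ℝ => d * (t + r)⁻¹ - e)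
      (by fun_prop) (hd.sub continuousOn_const),
    cfc_sub (fun r : ℝ => d * (t + r)⁻¹) (fun _ => e) a hd continuousOn_const,
    cfc_const e a, cfc_const_mul d _ a hinv, h_inverse, cfc_const_mul_id c a]

theorem operatorConvexOn_rpowIntegrand₁₂ (p : ℝ) {t : ℝ} (ht : 0 < t) :
    ConvexOn ℝ (Set.Ici (0 : A)) (cfc (Real.rpowIntegrand₁₂ p t)) := by
  refine ConvexOn.congr ?_ fun a ha => (cfc_rpowIntegrand₁₂_eq (Set.mem_Ici.1 ha) ht p).symm
  exact ((convexOn_id (convex_Ici 0)).smul (by positivity)).add <|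
    ((CStarAlgebra.convexOn_ringInverse_algebraMap_add ht).smul (by positivity)).sub
      (concaveOn_const _ (convex_Ici 0))

theorem operatorConvexOn_rpow {p : ℝ} (hp : p ∈ Set.Ioo 1 2) :
    ConvexOn ℝ (Set.Ici (0 : A)) (fun a : A => a ^ p) := by
  lift p to NNReal using zero_le_one.trans hp.1.le
  have hp' : p ∈ Set.Ioo 1 2 := by exact_mod_cast hp
  obtain ⟨μ, hμ⟩ := CFC.exists_measure_nnrpow_eq_integral_cfcₙ_rpowIntegrand₁₂ A hp'
  have h_integral : (Set.Ici 0).EqOn (fun a : A => a ^ (p : ℝ))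
      (fun a : A => ∫ t in Set.Ioi 0, cfcₙ (Real.rpowIntegrand₁₂ p t) a ∂μ) := by
    intro a ha
    simpa only [CFC.nnrpow_eq_rpow (zero_lt_one.trans hp'.1)] using (hμ a ha).2
  refine ConvexOn.congr ?_ h_integral.symm
  refine MeasureTheory.integral_convexOn_of_integrand_ae (convex_Ici _) ?_ fun a ha => (hμ a ha).1
  filter_upwards [MeasureTheory.ae_restrict_mem measurableSet_Ioi] with t ht
  refine (operatorConvexOn_rpowIntegrand₁₂ p ht).congr fun a ha => ?_
  have hcont : ContinuousOn (Real.rpowIntegrand₁₂ p t) (quasispectrum ℝ a) := by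
    have hne : ∀ z ∈ quasispectrum ℝ a, t + z ≠ 0 := fun z hz =>
      (add_pos_of_pos_of_nonneg ht (quasispectrum_nonneg_of_nonneg a ha z hz)).ne'
    unfold Real.rpowIntegrand₁₂
    fun_prop (disch := assumption)
  rw [cfcₙ_eq_cfc hcont (Real.rpowIntegrand₁₂_zero ht)]

theorem add_rpow_le {a b : A} (ha : 0 ≤ a) (hb : 0 ≤ b) {s : ℝ} (hs : 0 < s) (hs1 : s < 1) :
    (a + b) ^ (1 + s) ≤ (2 : ℝ) ^ s • (a ^ (1 + s) + b ^ (1 + s)) := by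
  have hmid := (operatorConvexOn_rpow (A := A) (p := 1 + s) ⟨by linarith, by linarith⟩).2
    (Set.mem_Ici.2 ha) (Set.mem_Ici.2 hb) (by norm_num : (0 : ℝ) ≤ 2⁻¹)
    (by norm_num : (0 : ℝ) ≤ 2⁻¹) (by norm_num)
  simp only [← smul_add] at hmid
  rw [smul_rpow_of_nonneg (add_nonneg ha hb) (by norm_num) (by positivity)] at hmid
  have h := smul_le_smul_of_nonneg_left hmid (a := (2 : ℝ) ^ (1 + s)) (by positivity)
  rwa [smul_smul, smul_smul, ← Real.mul_rpow (by norm_num) (by norm_num),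
    mul_inv_cancel₀ two_ne_zero, Real.one_rpow, one_smul, Real.rpow_add two_pos, Real.rpow_one,
    mul_right_comm, mul_inv_cancel₀ two_ne_zero, one_mul] at h

theorem sqrt_mul_rpow_mul_sqrt (a : A) {s : ℝ} (hs : 0 < s) :
    CFC.sqrt a * a ^ s * CFC.sqrt a = a ^ (1 + s) := by
  rw [CFC.sqrt_eq_rpow, rpow_mul_rpow_of_pos (by norm_num) hs,
    rpow_mul_rpow_of_pos (by positivity) (by norm_num)]
  ring_nf

theorem sqrt_rpow_mul_sqrt (a : A) {s : ℝ} (hs : 0 < s) :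
    CFC.sqrt (a ^ s) * CFC.sqrt a = CFC.sqrt (a ^ (1 + s)) := by
  rw [sqrt_rpow_of_nonneg hs.le, sqrt_rpow_of_nonneg (by positivity), CFC.sqrt_eq_rpow,
    rpow_mul_rpow_of_pos (by positivity) (by norm_num)]
  ring_nf

theorem sqrt_mul_sqrt_rpow (a : A) {s : ℝ} (hs : 0 < s) :
    CFC.sqrt a * CFC.sqrt (a ^ s) = CFC.sqrt (a ^ (1 + s)) := by
  rw [sqrt_rpow_of_nonneg hs.le, sqrt_rpow_of_nonneg (by positivity), CFC.sqrt_eq_rpow,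
    rpow_mul_rpow_of_pos (by norm_num) (by positivity)]
  ring_nf

theorem sqrt_rpow_sqrt_conj (a b : A) {s : ℝ} (hs : 0 < s) :
    CFC.sqrt (a ^ s) * (CFC.sqrt a * b * CFC.sqrt a) * CFC.sqrt (a ^ s) =
      CFC.sqrt (a ^ (1 + s)) * b * CFC.sqrt (a ^ (1 + s)) := by
  rw [← sqrt_rpow_mul_sqrt a hs]
  nth_rw 2 [sqrt_rpow_mul_sqrt a hs]
  rw [← sqrt_mul_sqrt_rpow a hs]
  noncomm_ring

theorem sqrt_rpow_conj {a : A} (ha : 0 ≤ a) {s : ℝ} (hs : 0 < s) :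
    CFC.sqrt (a ^ s) * a * CFC.sqrt (a ^ s) = a ^ (1 + s) := by
  have h := sqrt_rpow_sqrt_conj a 1 hs
  rwa [mul_one, mul_one, CFC.sqrt_mul_sqrt_self a ha,
    CFC.sqrt_mul_sqrt_self (a ^ (1 + s)) CFC.rpow_nonneg] at h

end FunctionalCalculus

section ApproximateInverse

/-- A continuous increasing sequence of approximations to the inverse of a nonnegative real. -/
noncomputable def approxInv (n : ℕ) (x : ℝ) : ℝ := (max x 0 + 1 / ((n : ℝ) + 1))⁻¹

theorem continuous_approxInv (n : ℕ) : Continuous (approxInv n) :=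
  Continuous.inv₀ (by fun_prop) fun x => by positivity

theorem continuous_mul_approxInv (n : ℕ) : Continuous fun x => x * approxInv n x :=
  continuous_id.mul (continuous_approxInv n)

theorem approxInv_nonneg (n : ℕ) (x : ℝ) : 0 ≤ approxInv n x := by
  unfold approxInv
  positivity

theorem approxInv_le_succ (n : ℕ) (x : ℝ) : approxInv n x ≤ approxInv (n + 1) x := by
  unfold approxInv
  gcongr
  exact n.le_succ

theorem mul_approxInv_le_one (n : ℕ) {x : ℝ} (hx : 0 ≤ x) : x * approxInv n x ≤ 1 := by
  rw [approxInv, mul_inv_le_iff₀ (by positivity), max_eq_left hx, one_mul]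
  exact le_add_of_nonneg_right (by positivity)

theorem sub_mul_approxInv_mul (n : ℕ) {x : ℝ} (hx : 0 ≤ x) :
    x - x * approxInv n x * x = 1 / ((n : ℝ) + 1) * (x * approxInv n x) := by
  rw [approxInv, max_eq_left hx]
  field_simp
  ring

end ApproximateInverse

section ApproximateUnit

variable {A : Type*} [CStarAlgebra A]

theorem cfc_mul_approxInv_eq_mul {a : A} (ha : IsSelfAdjoint a) (n : ℕ) :
    cfc (fun x => x * approxInv n x) a = cfc (approxInv n) a * a := by
  rw [cfc_mul (fun x : ℝ => x) _ a continuousOn_id (continuous_approxInv n).continuousOn,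
    (cfc_commute_cfc (fun x : ℝ => x) _ a).eq, cfc_id' ..]

variable [PartialOrder A] [StarOrderedRing A] {a : A}

theorem cfc_mul_approxInv_nonneg (ha : 0 ≤ a) (n : ℕ) :
    0 ≤ cfc (fun x => x * approxInv n x) a :=
  cfc_nonneg fun x hx => mul_nonneg (spectrum_nonneg_of_nonneg ha hx) (approxInv_nonneg n x)

theorem cfc_mul_approxInv_le_one (ha : 0 ≤ a) (n : ℕ) :
    cfc (fun x => x * approxInv n x) a ≤ 1 :=
  cfc_le_one _ _ fun _ hx => mul_approxInv_le_one n (spectrum_nonneg_of_nonneg ha hx)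

theorem monotone_cfc_mul_approxInv (ha : 0 ≤ a) :
    Monotone fun n => cfc (fun x => x * approxInv n x) a :=
  monotone_nat_of_le_succ fun n => cfc_mono
    (fun x hx => mul_le_mul_of_nonneg_left (approxInv_le_succ n x)
      (spectrum_nonneg_of_nonneg ha hx))
    (continuous_mul_approxInv n).continuousOn (continuous_mul_approxInv (n + 1)).continuousOn

theorem norm_sub_cfc_mul_approxInv_mul_le (ha : 0 ≤ a) (n : ℕ) :
    ‖a - cfc (fun x => x * approxInv n x) a * a‖ ≤ 1 / ((n : ℝ) + 1) := by
  have hc := (continuous_mul_approxInv n).continuousOn (s := spectrum ℝ a)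
  have h_cfc : a - cfc (fun x => x * approxInv n x) a * a =
      cfc (fun x => x - x * approxInv n x * x) a := by
    rw [cfc_sub (fun x : ℝ => x) (fun x => x * approxInv n x * x) a continuousOn_id
        (hc.mul continuousOn_id),
      cfc_mul (fun x => x * approxInv n x) (fun x => x) a hc continuousOn_id, cfc_id' ..]
  rw [h_cfc]
  refine norm_cfc_le (by positivity) fun x hx => ?_
  have hx0 : 0 ≤ x := spectrum_nonneg_of_nonneg ha hx
  have hn : (0 : ℝ) ≤ 1 / ((n : ℝ) + 1) := by positivity
  rw [sub_mul_approxInv_mul n hx0,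
    Real.norm_of_nonneg (mul_nonneg hn (mul_nonneg hx0 (approxInv_nonneg n x)))]
  exact mul_le_of_le_one_right hn (mul_approxInv_le_one n hx0)

theorem tendsto_cfc_mul_approxInv_mul (ha : 0 ≤ a) :
    Filter.Tendsto (fun n => cfc (fun x => x * approxInv n x) a * a) Filter.atTop (nhds a) := by
  rw [tendsto_iff_norm_sub_tendsto_zero]
  refine squeeze_zero (fun n => norm_nonneg _) (fun n => ?_)
    tendsto_one_div_add_atTop_nhds_zero_nat
  rw [norm_sub_rev]
  exact norm_sub_cfc_mul_approxInv_mul_le ha n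

end ApproximateUnit

section RightSupport

variable {H : Type*} [NormedAddCommGroup H] [InnerProductSpace ℂ H] [CompleteSpace H]

/-- The right support of `X`: the projection onto the orthogonal complement of its kernel. -/
noncomputable def rightSupport (X : H →L[ℂ] H) : H →L[ℂ] H := 1 - X.ker.starProjection

theorem isStarProjection_rightSupport (X : H →L[ℂ] H) : IsStarProjection (rightSupport X) :=
  isStarProjection_starProjection.one_sub

theorem mul_ker_starProjection {X : H →L[ℂ] H} :
    X * X.ker.starProjection = 0 := by
  ext v
  exact Submodule.starProjection_apply_mem X.ker v

theorem mul_rightSupport (X : H →L[ℂ] H) : X * rightSupport X = X := by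
  rw [rightSupport, mul_sub, mul_ker_starProjection, mul_one, sub_zero]

theorem rightSupport_mul_eq_zero {X Y : H →L[ℂ] H} (h : X * Y = 0) : rightSupport X * Y = 0 := by
  ext v
  have hv : Y v ∈ X.ker := congr($h v)
  simp [rightSupport, Submodule.starProjection_eq_self_iff.2 hv]

theorem rightSupport_le {X e : H →L[ℂ] H} (he : IsStarProjection e) (h : X * e = X) :
    rightSupport X ≤ e := by
  refine (isStarProjection_rightSupport X).le_of_mul_eq_left he ?_
  rw [← sub_eq_zero, ← neg_eq_zero, neg_sub]
  nth_rw 1 [← mul_one (rightSupport X)]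
  rw [← mul_sub]
  exact rightSupport_mul_eq_zero (by rw [mul_sub, h, mul_one, sub_self])

theorem rightSupport_star_mul_self (X : H →L[ℂ] H) :
    rightSupport (star X * X) = rightSupport X := by
  have h : (star X * X).ker = X.ker := X.ker_adjoint_comp_self
  simp only [rightSupport, h]

theorem mul_rightSupport_of_le {S T : H →L[ℂ] H} (hS : 0 ≤ S) (hST : S ≤ T) :
    S * rightSupport T = S := by
  have h_sandwich : (1 - rightSupport T) * S * (1 - rightSupport T) = 0 := by
    have he : IsStarProjection (1 - rightSupport T) := (isStarProjection_rightSupport T).one_sub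
    refine le_antisymm ?_ (he.isSelfAdjoint.conjugate_nonneg hS)
    refine (he.isSelfAdjoint.conjugate_le_conjugate hST).trans_eq ?_
    rw [mul_assoc, mul_sub, mul_rightSupport, mul_one, sub_self, mul_zero]
  have h_zero : CFC.sqrt S * (1 - rightSupport T) = 0 := by
    rw [← CStarRing.star_mul_self_eq_zero_iff, star_mul, (CFC.sqrt_nonneg S).isSelfAdjoint.star_eq,
      (isStarProjection_rightSupport T).one_sub.isSelfAdjoint.star_eq, ← h_sandwich]
    nth_rw 3 [← CFC.sqrt_mul_sqrt_self S hS]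
    noncomm_ring
  rw [← sub_eq_zero, ← neg_eq_zero, neg_sub]
  nth_rw 1 [← mul_one S]
  rw [← mul_sub, ← CFC.sqrt_mul_sqrt_self S hS, mul_assoc, h_zero, mul_zero]

theorem rightSupport_conj_of_le {S T : H →L[ℂ] H} (hS : 0 ≤ S) (hST : S ≤ T) :
    rightSupport T * S * rightSupport T = S := by
  have h := congr(star $(mul_rightSupport_of_le hS hST))
  rw [star_mul, hS.isSelfAdjoint.star_eq,
    (isStarProjection_rightSupport T).isSelfAdjoint.star_eq] at h
  rw [h, mul_rightSupport_of_le hS hST]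

theorem rightSupport_posPart_conj {X : H →L[ℂ] H} (hX : IsSelfAdjoint X) :
    rightSupport X⁺ * X * rightSupport X⁺ = X⁺ := by
  nth_rw 2 [← CFC.posPart_sub_negPart X hX]
  rw [mul_sub, rightSupport_mul_eq_zero (CFC.posPart_mul_negPart X), sub_zero]
  exact rightSupport_conj_of_le (CFC.posPart_nonneg X) le_rfl

theorem rightSupport_mem_vonNeumann {N : VonNeumannAlgebra H} {X : H →L[ℂ] H} (hX : X ∈ N) :
    rightSupport X ∈ N := by
  refine sub_mem (one_mem N) ?_
  rw [VonNeumannAlgebra.IsStarProjection.mem_iff isStarProjection_starProjection]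
  intro y hy v hv
  simp only [Submodule.range_starProjection] at hv ⊢
  have hv' : X v = 0 := hv
  have h_comm : X (y v) = y (X v) := congr($(VonNeumannAlgebra.mem_commutant_iff.1 hy X hX) v)
  exact h_comm.trans (by rw [hv', _root_.map_zero])

theorem cfc_mul_approxInv_mul_rightSupport {a : H →L[ℂ] H} (ha : IsSelfAdjoint a) (n : ℕ) :
    cfc (fun x => x * approxInv n x) a * rightSupport a = cfc (fun x => x * approxInv n x) a := by
  rw [cfc_mul_approxInv_eq_mul ha, mul_assoc, mul_rightSupport]

theorem cfc_mul_approxInv_le_rightSupport {a : H →L[ℂ] H} (ha : 0 ≤ a) (n : ℕ) :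
    cfc (fun x => x * approxInv n x) a ≤ rightSupport a := by
  have hs := isStarProjection_rightSupport a
  have h := hs.isSelfAdjoint.conjugate_le_conjugate (cfc_mul_approxInv_le_one ha n)
  have h_left := congr(star $(cfc_mul_approxInv_mul_rightSupport ha.isSelfAdjoint n))
  rw [star_mul, hs.isSelfAdjoint.star_eq,
    (cfc_mul_approxInv_nonneg ha n).isSelfAdjoint.star_eq] at h_left
  rwa [h_left, cfc_mul_approxInv_mul_rightSupport ha.isSelfAdjoint, mul_one,
    hs.isIdempotentElem.eq] at h

theorem rightSupport_apply_mem_closure_range {a : H →L[ℂ] H} (ha : IsSelfAdjoint a) (v : H) :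
    rightSupport a v ∈ closure (Set.range a) := by
  have h : rightSupport a v ∈ a.kerᗮ := Submodule.sub_starProjection_mem_orthogonal v
  rwa [ContinuousLinearMap.orthogonal_ker, ha.adjoint_eq] at h

theorem tendsto_cfc_mul_approxInv_apply {a : H →L[ℂ] H} (ha : 0 ≤ a) (v : H) :
    Filter.Tendsto (fun n => cfc (fun x => x * approxInv n x) a v) Filter.atTop
      (nhds (rightSupport a v)) := by
  set E : ℕ → H →L[ℂ] H := fun n => cfc (fun x => x * approxInv n x) a
  have h_lipschitz (n : ℕ) : LipschitzWith 1 (E n) :=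
    (E n).lipschitz.weaken <| (CStarAlgebra.norm_le_one_iff_of_nonneg _
      (cfc_mul_approxInv_nonneg ha n)).2 (cfc_mul_approxInv_le_one ha n)
  have h_closed : IsClosed {u | Filter.Tendsto (fun n => E n u) Filter.atTop (nhds u)} :=
    (LipschitzWith.uniformEquicontinuous (fun n u => E n u) 1
      h_lipschitz).equicontinuous.isClosed_setOfPred_tendsto continuous_id
  have h_range : Set.range a ⊆ {u | Filter.Tendsto (fun n => E n u) Filter.atTop (nhds u)} := by
    rintro _ ⟨w, rfl⟩
    exact ((ContinuousLinearMap.apply ℂ H w).continuous.tendsto a).comp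
      (tendsto_cfc_mul_approxInv_mul ha)
  refine (h_closed.closure_subset_iff.2 h_range
    (rightSupport_apply_mem_closure_range ha.isSelfAdjoint v)).congr fun n => ?_
  exact congr($(cfc_mul_approxInv_mul_rightSupport ha.isSelfAdjoint n) v)

theorem isLUB_rightSupport {a : H →L[ℂ] H} (ha : 0 ≤ a) :
    IsLUB (Set.range fun n => cfc (fun x => x * approxInv n x) a) (rightSupport a) := by
  refine ⟨Set.forall_mem_range.2 fun n => cfc_mul_approxInv_le_rightSupport ha n, fun R hR => ?_⟩
  have hER (n : ℕ) : cfc (fun x => x * approxInv n x) a ≤ R := hR ⟨n, rfl⟩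
  have hR0 : 0 ≤ R := (cfc_mul_approxInv_nonneg ha 0).trans (hER 0)
  rw [ContinuousLinearMap.le_def, ContinuousLinearMap.isPositive_def']
  refine ⟨hR0.isSelfAdjoint.sub (isStarProjection_rightSupport a).isSelfAdjoint, fun v => ?_⟩
  have h_lim := (RCLike.continuous_re.tendsto _).comp
    ((tendsto_const_nhds.sub (tendsto_cfc_mul_approxInv_apply ha v)).inner
      (tendsto_const_nhds (x := v)) (𝕜 := ℂ) (f := fun n => R v - _))
  exact ge_of_tendsto h_lim (.of_forall fun n => ((ContinuousLinearMap.le_def _ _).1 (hER n)).2 v)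

end RightSupport

section Trace

variable {H : Type*} [NormedAddCommGroup H] [InnerProductSpace ℂ H] [CompleteSpace H]

theorem cfc_conj_cfc {A : Type*} [CStarAlgebra A] {a : A} (ha : IsSelfAdjoint a) {h : ℝ → ℝ}
    (hh : Continuous h) : cfc h a * a * cfc h a = cfc (fun r => r * (h r * h r)) a := by
  rw [cfc_mul (fun r : ℝ => r) (fun r => h r * h r) a continuousOn_id (hh.mul hh).continuousOn,
    cfc_mul h h a hh.continuousOn hh.continuousOn, cfc_id' .., ← mul_assoc]
  congr 1
  simpa only [cfc_id' ℝ a ha] using (cfc_commute_cfc h (fun r : ℝ => r) a).eq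

namespace FNSTrace

variable {N : VonNeumannAlgebra H} (τ : FNSTrace N)

theorem map_zero : τ.toFun 0 = 0 := by
  simpa using τ.map_smul' 0 le_rfl 0 (zero_mem N) le_rfl

theorem map_sum {ι : Type*} (s : Finset ι) {X : ι → H →L[ℂ] H} (hX : ∀ i ∈ s, X i ∈ N)
    (h0 : ∀ i ∈ s, 0 ≤ X i) : τ.toFun (∑ i ∈ s, X i) = ∑ i ∈ s, τ.toFun (X i) := by
  induction s using Finset.cons_induction with
  | empty => simpa using τ.map_zero
  | cons i s hi ih =>
    simp only [Finset.mem_cons, forall_eq_or_imp] at hX h0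
    rw [Finset.sum_cons, Finset.sum_cons,
      τ.map_add' _ hX.1 _ (sum_mem hX.2) h0.1 (Finset.sum_nonneg h0.2), ih hX.2 h0.2]

theorem mono {A B : H →L[ℂ] H} (hA : A ∈ N) (hB : B ∈ N) (h0 : 0 ≤ A) (h : A ≤ B) :
    τ.toFun A ≤ τ.toFun B := by
  have h_add := τ.map_add' A hA (B - A) (sub_mem hB hA) h0 (sub_nonneg.2 h)
  rw [add_sub_cancel] at h_add
  exact h_add ▸ le_self_add

theorem eq_iSup_of_isLUB_range {X : ℕ → H →L[ℂ] H} {Y : H →L[ℂ] H} (hX : ∀ n, X n ∈ N)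
    (h0 : ∀ n, 0 ≤ X n) (hm : Monotone X) (hlub : IsLUB (Set.range X) Y) (hY : Y ∈ N) :
    τ.toFun Y = ⨆ n, τ.toFun (X n) := by
  rw [τ.normal' (Set.range X) (Set.forall_mem_range.2 fun n => ⟨hX n, h0 n⟩)
    (Set.range_nonempty X) hm.directed_le.directedOn_range Y hY hlub, iSup_range]

theorem cfc_le_of_tendsto {a : H →L[ℂ] H} (ha : a ∈ N) {c : ℝ≥0∞} {h : ℕ → ℝ → ℝ} {f : ℝ → ℝ}
    (hh : ∀ n, Continuous (h n)) (hf : Continuous f) (h0 : ∀ n, ∀ x ∈ spectrum ℝ a, 0 ≤ h n x)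
    (hm : ∀ n, ∀ x ∈ spectrum ℝ a, h n x ≤ h (n + 1) x)
    {ε : ℕ → ℝ} (hε : Filter.Tendsto ε Filter.atTop (nhds 0)) (hε0 : ∀ n, 0 ≤ ε n)
    (hle : ∀ n, ∀ x ∈ spectrum ℝ a, |h n x - f x| ≤ ε n)
    (hc : ∀ n, τ.toFun (cfc (h n) a) ≤ c) : τ.toFun (cfc f a) ≤ c := by
  have h_mono : Monotone fun n => cfc (h n) a := monotone_nat_of_le_succ fun n =>
    cfc_mono (hm n) (hh n).continuousOn (hh _).continuousOn
  have h_lim : Filter.Tendsto (fun n => cfc (h n) a) Filter.atTop (nhds (cfc f a)) := by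
    rw [tendsto_iff_norm_sub_tendsto_zero]
    refine squeeze_zero (fun n => norm_nonneg _) (fun n => ?_) hε
    rw [← cfc_sub (h n) f a (hh n).continuousOn hf.continuousOn]
    exact norm_cfc_le (hε0 n) (hle n)
  rw [τ.eq_iSup_of_isLUB_range (fun n => cfc_mem_vonNeumann ha _) (fun n => cfc_nonneg (h0 n))
    h_mono (isLUB_of_tendsto_atTop h_mono h_lim) (cfc_mem_vonNeumann ha _)]
  exact iSup_le hc

theorem conj_le {G Y : H →L[ℂ] H} (hG : G ∈ N) (hY : Y ∈ N) (hY0 : 0 ≤ Y)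
    (hG1 : star G * G ≤ 1) : τ.toFun (G * Y * star G) ≤ τ.toFun Y := by
  have h_star : star (CFC.sqrt Y) = CFC.sqrt Y := (CFC.sqrt_nonneg Y).isSelfAdjoint
  have hX : G * CFC.sqrt Y ∈ N := mul_mem hG (sqrt_mem_vonNeumann hY)
  have h_swap : G * Y * star G = G * CFC.sqrt Y * star (G * CFC.sqrt Y) := by
    rw [star_mul, h_star]
    nth_rw 1 [← CFC.sqrt_mul_sqrt_self Y hY0]
    noncomm_ring
  rw [h_swap, ← τ.tracial' _ hX]
  refine τ.mono (mul_mem (star_mem hX) hX) hY (star_mul_self_nonneg _) ?_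
  calc star (G * CFC.sqrt Y) * (G * CFC.sqrt Y)
      = CFC.sqrt Y * (star G * G) * CFC.sqrt Y := by rw [star_mul, h_star]; noncomm_ring
    _ ≤ CFC.sqrt Y * 1 * CFC.sqrt Y :=
      IsSelfAdjoint.conjugate_le_conjugate hG1 (CFC.sqrt_nonneg Y).isSelfAdjoint
    _ = Y := by rw [mul_one, CFC.sqrt_mul_sqrt_self Y hY0]

theorem sqrt_conj_comm {a b : H →L[ℂ] H} (ha : a ∈ N) (hb : b ∈ N) (ha0 : 0 ≤ a) (hb0 : 0 ≤ b) :
    τ.toFun (CFC.sqrt a * b * CFC.sqrt a) = τ.toFun (CFC.sqrt b * a * CFC.sqrt b) := by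
  have h := τ.tracial' (CFC.sqrt b * CFC.sqrt a)
    (mul_mem (sqrt_mem_vonNeumann hb) (sqrt_mem_vonNeumann ha))
  rw [star_mul, (CFC.sqrt_nonneg a).isSelfAdjoint.star_eq,
    (CFC.sqrt_nonneg b).isSelfAdjoint.star_eq] at h
  convert h using 2
  · nth_rw 1 [← CFC.sqrt_mul_sqrt_self b hb0]
    noncomm_ring
  · nth_rw 1 [← CFC.sqrt_mul_sqrt_self a ha0]
    noncomm_ring

theorem cfc_star_mul_self {X : H →L[ℂ] H} (hX : X ∈ N) {g : ℝ → ℝ} (hg : Continuous g)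
    (hg0 : ∀ x, 0 ≤ g x) :
    τ.toFun (cfc (fun r => r * g r) (star X * X)) =
      τ.toFun (cfc (fun r => r * g r) (X * star X)) := by
  obtain ⟨h, hh, h_sq⟩ : ∃ h : ℝ → ℝ, Continuous h ∧ g = fun r => h r * h r :=
    ⟨fun r => √(g r), hg.sqrt, funext fun r => (Real.mul_self_sqrt (hg0 r)).symm⟩
  have h_star : star (cfc h (star X * X)) = cfc h (star X * X) :=
    (cfc_predicate h (star X * X) : IsSelfAdjoint _)
  have h_tracial := τ.tracial' (X * cfc h (star X * X))
    (mul_mem hX (cfc_mem_vonNeumann (mul_mem (star_mem hX) hX) h))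
  rw [star_mul, h_star] at h_tracial
  rw [← mul_cfc_star_mul_self_mul_star X hg]
  subst h_sq
  rw [← cfc_conj_cfc (.star_mul_self X) hh, cfc_mul h h _ hh.continuousOn hh.continuousOn]
  convert h_tracial using 2 <;> noncomm_ring

theorem rightSupport_eq_iSup {a : H →L[ℂ] H} (ha : a ∈ N) (ha0 : 0 ≤ a) :
    τ.toFun (rightSupport a) = ⨆ n, τ.toFun (cfc (fun x => x * approxInv n x) a) :=
  τ.eq_iSup_of_isLUB_range (fun _ => cfc_mem_vonNeumann ha _) (cfc_mul_approxInv_nonneg ha0)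
    (monotone_cfc_mul_approxInv ha0) (isLUB_rightSupport ha0) (rightSupport_mem_vonNeumann ha)

theorem rightSupport_star {X : H →L[ℂ] H} (hX : X ∈ N) :
    τ.toFun (rightSupport (star X)) = τ.toFun (rightSupport X) := by
  have h_range : rightSupport (X * star X) = rightSupport (star X) := by
    simpa only [star_star] using rightSupport_star_mul_self (star X)
  rw [← rightSupport_star_mul_self X, ← h_range,
    τ.rightSupport_eq_iSup (mul_mem (star_mem hX) hX) (star_mul_self_nonneg X),
    τ.rightSupport_eq_iSup (mul_mem hX (star_mem hX)) (mul_star_self_nonneg X)]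
  simp only [τ.cfc_star_mul_self hX (continuous_approxInv _) (approxInv_nonneg _)]

theorem rightSupport_mul_le {e Y : H →L[ℂ] H} (he : e ∈ N) (hproj : IsStarProjection e)
    (hY : Y ∈ N) : τ.toFun (rightSupport (e * Y)) ≤ τ.toFun e := by
  rw [← τ.rightSupport_star (mul_mem he hY)]
  refine τ.mono (rightSupport_mem_vonNeumann (star_mem (mul_mem he hY))) he
    (isStarProjection_rightSupport _).nonneg (rightSupport_le hproj ?_)
  rw [star_mul, hproj.isSelfAdjoint.star_eq, mul_assoc, hproj.isIdempotentElem.eq]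

theorem posPart_le {X Y : H →L[ℂ] H} (hX : X ∈ N) (hY : Y ∈ N) (hXs : IsSelfAdjoint X)
    (hY0 : 0 ≤ Y) (hXY : X ≤ Y) : τ.toFun X⁺ ≤ τ.toFun Y := by
  have he : IsStarProjection (rightSupport X⁺) := isStarProjection_rightSupport _
  have he_mem : rightSupport X⁺ ∈ N := rightSupport_mem_vonNeumann (posPart_mem_vonNeumann hX)
  have h_compress := τ.conj_le he_mem hY hY0
    (by rw [he.isSelfAdjoint.star_eq, he.isIdempotentElem.eq]; exact he.le_one)
  rw [he.isSelfAdjoint.star_eq] at h_compress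
  refine (τ.mono (posPart_mem_vonNeumann hX) (mul_mem (mul_mem he_mem hY) he_mem)
    (CFC.posPart_nonneg X) ?_).trans h_compress
  nth_rw 1 [← rightSupport_posPart_conj hXs]
  exact he.isSelfAdjoint.conjugate_le_conjugate hXY

theorem exists_projection_le_inf {p q : H →L[ℂ] H} (hp : p ∈ N) (hpp : IsStarProjection p)
    (hq : q ∈ N) (hqq : IsStarProjection q) :
    ∃ r ∈ N, IsStarProjection r ∧ p * r = r ∧ q * r = r ∧
      τ.toFun (p - r) ≤ τ.toFun (1 - q) := by
  set s := rightSupport ((1 - q) * p)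
  have hX : (1 - q) * p ∈ N := mul_mem (sub_mem (one_mem N) hq) hp
  have hs_proj : IsStarProjection s := isStarProjection_rightSupport _
  have hs_le : s ≤ p :=
    rightSupport_le hpp (by rw [mul_assoc, hpp.isIdempotentElem.eq])
  have hps : p * s = s := (hs_proj.le_iff_mul_eq_right hpp).1 hs_le
  have hpr : p * (p - s) = p - s := by rw [mul_sub, hpp.isIdempotentElem.eq, hps]
  refine ⟨p - s, sub_mem hp (rightSupport_mem_vonNeumann hX),
    (hs_proj.le_iff_sub hpp).1 hs_le, hpr, ?_, ?_⟩
  · have h_zero : (1 - q) * (p - s) = 0 := by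
      rw [← hpr, ← mul_assoc, mul_sub, mul_rightSupport, mul_assoc, hpp.isIdempotentElem.eq,
        sub_self]
    rwa [sub_mul, one_mul, sub_eq_zero, eq_comm] at h_zero
  · rw [sub_sub_cancel]
    exact τ.rightSupport_mul_le (sub_mem (one_mem N) hq) hqq.one_sub hp

end FNSTrace

end Trace

section Polarization

variable {A : Type*} [Ring A] [StarRing A] [Algebra ℂ A] [StarModule ℂ A]

theorem realPart_add_I_smul {X Y : A} (hX : IsSelfAdjoint X) (hY : IsSelfAdjoint Y) :
    (ℜ (X + Complex.I • Y) : A) = X := by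
  rw [map_add, realPart_I_smul, hY.imaginaryPart, neg_zero, add_zero, hX.coe_realPart]

theorem imaginaryPart_add_I_smul {X Y : A} (hX : IsSelfAdjoint X) (hY : IsSelfAdjoint Y) :
    (ℑ (X + Complex.I • Y) : A) = Y := by
  rw [map_add, imaginaryPart_I_smul, hX.imaginaryPart, zero_add, hY.coe_realPart]

theorem I_smul_combination {E : Type*} [AddCommGroup E] [Module ℂ E] (P₁ P₂ P₃ P₄ : E) :
    Complex.I • ((P₁ - P₂) + Complex.I • (P₃ - P₄)) = (P₄ - P₃) + Complex.I • (P₁ - P₂) := by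
  rw [smul_add, smul_smul, Complex.I_mul_I]
  module

/-- The vectors `(X + c Z) / 2`, with `c` a fourth root of unity, of the polarization identity. -/
noncomputable def polarVec (X Z : A) (c : ℂ) : A := (2⁻¹ : ℂ) • (X + c • Z)

theorem star_polarVec_mul_self (X Z : A) (c : ℂ) :
    star (polarVec X Z c) * polarVec X Z c = (4⁻¹ : ℂ) • (star X * X + c • (star X * Z) +
      star c • (star Z * X) + (star c * c) • (star Z * Z)) := by
  simp only [polarVec, star_smul, star_add, add_mul, mul_add, mul_smul_comm, smul_mul_assoc,
    star_inv₀, star_ofNat]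
  module

theorem polarVec_mul_star_self (X Z : A) (c : ℂ) :
    polarVec X Z c * star (polarVec X Z c) = (4⁻¹ : ℂ) • (X * star X + c • (Z * star X) +
      star c • (X * star Z) + (star c * c) • (Z * star Z)) := by
  simp only [polarVec, star_smul, star_add, add_mul, mul_add, mul_smul_comm, smul_mul_assoc,
    star_inv₀, star_ofNat]
  module

theorem star_mul_eq_polarization (X Z : A) :
    star X * Z =
      (star (polarVec X Z 1) * polarVec X Z 1 - star (polarVec X Z (-1)) * polarVec X Z (-1)) +
        Complex.I • (star (polarVec X Z (-Complex.I)) * polarVec X Z (-Complex.I) -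
          star (polarVec X Z Complex.I) * polarVec X Z Complex.I) := by
  simp only [star_polarVec_mul_self, star_neg, star_one, RCLike.star_def, Complex.conj_I]
  match_scalars <;> ring_nf <;> simp
  norm_num

theorem mul_star_eq_polarization (X Z : A) :
    Z * star X =
      (polarVec X Z 1 * star (polarVec X Z 1) - polarVec X Z (-1) * star (polarVec X Z (-1))) +
        Complex.I • (polarVec X Z (-Complex.I) * star (polarVec X Z (-Complex.I)) -
          polarVec X Z Complex.I * star (polarVec X Z Complex.I)) := by
  simp only [polarVec_mul_star_self, star_neg, star_one, RCLike.star_def, Complex.conj_I]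
  match_scalars <;> ring_nf <;> simp
  norm_num

theorem star_polarVec_mul_self_add_star_polarVec_neg_mul_self (X Z : A) {c : ℂ} (hc : ‖c‖ = 1) :
    star (polarVec X Z c) * polarVec X Z c + star (polarVec X Z (-c)) * polarVec X Z (-c) =
      (2⁻¹ : ℂ) • (star X * X + star Z * Z) := by
  have hcc : star c * c = 1 := by simpa [hc] using Complex.conj_mul' c
  simp only [star_polarVec_mul_self, star_neg, neg_mul_neg, hcc]
  module

theorem star_polarVec_mul_self_le {A : Type*} [CStarAlgebra A] [PartialOrder A] [StarOrderedRing A]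
    (X Z : A) {c : ℂ} (hc : ‖c‖ = 1) :
    star (polarVec X Z c) * polarVec X Z c ≤ star X * X + star Z * Z := by
  have hsum : 0 ≤ star X * X + star Z * Z :=
    add_nonneg (star_mul_self_nonneg X) (star_mul_self_nonneg Z)
  calc star (polarVec X Z c) * polarVec X Z c
      ≤ star (polarVec X Z c) * polarVec X Z c +
          star (polarVec X Z (-c)) * polarVec X Z (-c) :=
        le_add_of_nonneg_right (star_mul_self_nonneg _)
    _ = (2⁻¹ : ℂ) • (star X * X + star Z * Z) :=
        star_polarVec_mul_self_add_star_polarVec_neg_mul_self X Z hc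
    _ = (2⁻¹ : ℝ) • (star X * X + star Z * Z) := by
        rw [← Complex.coe_smul]; push_cast; rfl
    _ ≤ star X * X + star Z * Z := smul_le_of_le_one_left hsum (by norm_num)

end Polarization

section TracialFunctional

variable {H : Type*} [NormedAddCommGroup H] [InnerProductSpace ℂ H] [CompleteSpace H]

/-- An additive real functional, invariant under `X* X ↦ X X*`, on a hereditary cone of positive
elements of a von Neumann algebra. Both the trace on its finite part and the zeta functionals are
of this kind. -/
structure TracialFunctional (N : VonNeumannAlgebra H) where
  cone : Set (H →L[ℂ] H)
  val : (H →L[ℂ] H) → ℝ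
  mem_alg : ∀ P ∈ cone, P ∈ N
  nonneg : ∀ P ∈ cone, 0 ≤ P
  zero_mem : 0 ∈ cone
  add_mem : ∀ P ∈ cone, ∀ Q ∈ cone, P + Q ∈ cone
  posPart_mem : ∀ P ∈ cone, ∀ X ∈ N, IsSelfAdjoint X → X ≤ P → X⁺ ∈ cone
  swap_mem : ∀ X ∈ N, star X * X ∈ cone → X * star X ∈ cone
  val_add : ∀ P ∈ cone, ∀ Q ∈ cone, val (P + Q) = val P + val Q
  val_swap : ∀ X ∈ N, star X * X ∈ cone → val (star X * X) = val (X * star X)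

theorem mul_eq_jordan_left (A B : H →L[ℂ] H) :
    A * B = ((ℜ A : H →L[ℂ] H)⁺ * B - (ℜ A : H →L[ℂ] H)⁻ * B) +
      Complex.I • ((ℑ A : H →L[ℂ] H)⁺ * B - (ℑ A : H →L[ℂ] H)⁻ * B) := by
  conv_lhs => rw [← CStarAlgebra.linear_combination_nonneg A]
  rw [add_mul, sub_mul, sub_mul, smul_sub, smul_mul_assoc, smul_mul_assoc]

theorem mul_eq_jordan_right (A B : H →L[ℂ] H) :
    A * B = (A * (ℜ B : H →L[ℂ] H)⁺ - A * (ℜ B : H →L[ℂ] H)⁻) +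
      Complex.I • (A * (ℑ B : H →L[ℂ] H)⁺ - A * (ℑ B : H →L[ℂ] H)⁻) := by
  conv_lhs => rw [← CStarAlgebra.linear_combination_nonneg B]
  rw [mul_add, mul_sub, mul_sub, smul_sub, mul_smul_comm, mul_smul_comm]

namespace TracialFunctional

variable {N : VonNeumannAlgebra H} (φ : TracialFunctional N)

/-- The linear span of the cone: the operators of `N` all of whose four positive parts lie in the
cone. -/
def domain : Set (H →L[ℂ] H) := {A | A ∈ N ∧ JordanForall (· ∈ φ.cone) A}

/-- The complex-linear extension of the functional to its domain. -/
noncomputable def ext (A : H →L[ℂ] H) : ℂ := jordanExtend (fun P => (φ.val P : ℂ)) A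

variable {φ}

section Cone

variable {P Q : H →L[ℂ] H}

theorem mem_of_le (hP : P ∈ φ.cone) (hQ : Q ∈ N) (h0 : 0 ≤ Q) (h : Q ≤ P) : Q ∈ φ.cone := by
  simpa only [(CFC.posPart_eq_self Q).2 h0] using φ.posPart_mem P hP Q hQ h0.isSelfAdjoint h

theorem nsmul_mem (hP : P ∈ φ.cone) (n : ℕ) : n • P ∈ φ.cone := by
  induction n with
  | zero => simpa only [zero_nsmul] using φ.zero_mem
  | succ n ih => rw [succ_nsmul]; exact φ.add_mem _ ih _ hP

theorem val_zero : φ.val 0 = 0 := by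
  simpa only [add_zero, left_eq_add] using φ.val_add 0 φ.zero_mem 0 φ.zero_mem

theorem val_nsmul (hP : P ∈ φ.cone) (n : ℕ) : φ.val (n • P) = n * φ.val P := by
  induction n with
  | zero => simp only [zero_nsmul, val_zero, Nat.cast_zero, zero_mul]
  | succ n ih => rw [succ_nsmul, φ.val_add _ (nsmul_mem hP n) _ hP, ih]; push_cast; ring

theorem isSelfAdjoint_sub (hP : P ∈ φ.cone) (hQ : Q ∈ φ.cone) : IsSelfAdjoint (P - Q) :=
  (φ.nonneg P hP).isSelfAdjoint.sub (φ.nonneg Q hQ).isSelfAdjoint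

theorem posPart_sub_mem (hP : P ∈ φ.cone) (hQ : Q ∈ φ.cone) : (P - Q)⁺ ∈ φ.cone :=
  φ.posPart_mem P hP _ (sub_mem (φ.mem_alg P hP) (φ.mem_alg Q hQ)) (isSelfAdjoint_sub hP hQ)
    (sub_le_self _ (φ.nonneg Q hQ))

theorem negPart_sub_mem (hP : P ∈ φ.cone) (hQ : Q ∈ φ.cone) : (P - Q)⁻ ∈ φ.cone := by
  rw [← CFC.posPart_neg, neg_sub]
  exact posPart_sub_mem hQ hP

theorem val_posPart_sub_val_negPart (hP : P ∈ φ.cone) (hQ : Q ∈ φ.cone) :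
    φ.val (P - Q)⁺ - φ.val (P - Q)⁻ = φ.val P - φ.val Q := by
  have hsum : (P - Q)⁺ + Q = P + (P - Q)⁻ := by
    rw [← sub_eq_sub_iff_add_eq_add, CFC.posPart_sub_negPart _ (isSelfAdjoint_sub hP hQ)]
  have hval := congr(φ.val $hsum)
  rw [φ.val_add _ (posPart_sub_mem hP hQ) _ hQ, φ.val_add _ hP _ (negPart_sub_mem hP hQ)] at hval
  linarith

end Cone

section Combination

variable {P₁ P₂ P₃ P₄ : H →L[ℂ] H}

theorem combination_mem (h₁ : P₁ ∈ φ.cone) (h₂ : P₂ ∈ φ.cone) (h₃ : P₃ ∈ φ.cone)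
    (h₄ : P₄ ∈ φ.cone) : (P₁ - P₂) + Complex.I • (P₃ - P₄) ∈ φ.domain := by
  refine ⟨AddMemClass.add_mem (sub_mem (φ.mem_alg _ h₁) (φ.mem_alg _ h₂))
    (complex_smul_mem_vonNeumann _ (sub_mem (φ.mem_alg _ h₃) (φ.mem_alg _ h₄))), ?_⟩
  unfold JordanForall
  rw [realPart_add_I_smul (isSelfAdjoint_sub h₁ h₂) (isSelfAdjoint_sub h₃ h₄),
    imaginaryPart_add_I_smul (isSelfAdjoint_sub h₁ h₂) (isSelfAdjoint_sub h₃ h₄)]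
  exact ⟨posPart_sub_mem h₁ h₂, negPart_sub_mem h₁ h₂, posPart_sub_mem h₃ h₄,
    negPart_sub_mem h₃ h₄⟩

theorem ext_combination (h₁ : P₁ ∈ φ.cone) (h₂ : P₂ ∈ φ.cone) (h₃ : P₃ ∈ φ.cone)
    (h₄ : P₄ ∈ φ.cone) : φ.ext ((P₁ - P₂) + Complex.I • (P₃ - P₄)) =
      (φ.val P₁ - φ.val P₂) + Complex.I * (φ.val P₃ - φ.val P₄) := by
  unfold ext jordanExtend
  rw [realPart_add_I_smul (isSelfAdjoint_sub h₁ h₂) (isSelfAdjoint_sub h₃ h₄),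
    imaginaryPart_add_I_smul (isSelfAdjoint_sub h₁ h₂) (isSelfAdjoint_sub h₃ h₄)]
  simp only [← Complex.ofReal_sub, val_posPart_sub_val_negPart h₁ h₂,
    val_posPart_sub_val_negPart h₃ h₄]

theorem exists_combination {A : H →L[ℂ] H} (hA : A ∈ φ.domain) :
    ∃ P₁ ∈ φ.cone, ∃ P₂ ∈ φ.cone, ∃ P₃ ∈ φ.cone, ∃ P₄ ∈ φ.cone,
      A = (P₁ - P₂) + Complex.I • (P₃ - P₄) := by
  refine ⟨_, hA.2.1, _, hA.2.2.1, _, hA.2.2.2.1, _, hA.2.2.2.2, ?_⟩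
  rw [smul_sub]
  exact (CStarAlgebra.linear_combination_nonneg A).symm

theorem ext_of_mem {P : H →L[ℂ] H} (hP : P ∈ φ.cone) : φ.ext P = φ.val P := by
  simpa [val_zero] using ext_combination hP φ.zero_mem φ.zero_mem φ.zero_mem

end Combination

section Linear

variable {A B : H →L[ℂ] H}

theorem add_mem_domain (hA : A ∈ φ.domain) (hB : B ∈ φ.domain) : A + B ∈ φ.domain := by
  obtain ⟨P₁, h₁, P₂, h₂, P₃, h₃, P₄, h₄, rfl⟩ := exists_combination hA
  obtain ⟨Q₁, k₁, Q₂, k₂, Q₃, k₃, Q₄, k₄, rfl⟩ := exists_combination hB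
  convert combination_mem (φ.add_mem _ h₁ _ k₁) (φ.add_mem _ h₂ _ k₂) (φ.add_mem _ h₃ _ k₃)
    (φ.add_mem _ h₄ _ k₄) using 1
  module

theorem ext_add (hA : A ∈ φ.domain) (hB : B ∈ φ.domain) : φ.ext (A + B) = φ.ext A + φ.ext B := by
  obtain ⟨P₁, h₁, P₂, h₂, P₃, h₃, P₄, h₄, rfl⟩ := exists_combination hA
  obtain ⟨Q₁, k₁, Q₂, k₂, Q₃, k₃, Q₄, k₄, rfl⟩ := exists_combination hB
  have hsum : (P₁ - P₂) + Complex.I • (P₃ - P₄) + ((Q₁ - Q₂) + Complex.I • (Q₃ - Q₄)) =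
      ((P₁ + Q₁) - (P₂ + Q₂)) + Complex.I • ((P₃ + Q₃) - (P₄ + Q₄)) := by
    module
  rw [hsum, ext_combination (φ.add_mem _ h₁ _ k₁) (φ.add_mem _ h₂ _ k₂) (φ.add_mem _ h₃ _ k₃)
    (φ.add_mem _ h₄ _ k₄), ext_combination h₁ h₂ h₃ h₄, ext_combination k₁ k₂ k₃ k₄,
    φ.val_add _ h₁ _ k₁, φ.val_add _ h₂ _ k₂, φ.val_add _ h₃ _ k₃, φ.val_add _ h₄ _ k₄]
  push_cast
  ring

theorem neg_mem_domain (hA : A ∈ φ.domain) : -A ∈ φ.domain := by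
  obtain ⟨P₁, h₁, P₂, h₂, P₃, h₃, P₄, h₄, rfl⟩ := exists_combination hA
  convert combination_mem h₂ h₁ h₄ h₃ using 1
  module

theorem ext_neg (hA : A ∈ φ.domain) : φ.ext (-A) = -φ.ext A := by
  have h := ext_add hA (neg_mem_domain hA)
  rw [add_neg_cancel, ext_of_mem φ.zero_mem, val_zero, Complex.ofReal_zero] at h
  exact (neg_eq_of_add_eq_zero_right h.symm).symm

theorem I_smul_mem_domain (hA : A ∈ φ.domain) : Complex.I • A ∈ φ.domain := by
  obtain ⟨P₁, h₁, P₂, h₂, P₃, h₃, P₄, h₄, rfl⟩ := exists_combination hA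
  rw [I_smul_combination]
  exact combination_mem h₄ h₃ h₁ h₂

theorem ext_I_smul (hA : A ∈ φ.domain) : φ.ext (Complex.I • A) = Complex.I * φ.ext A := by
  obtain ⟨P₁, h₁, P₂, h₂, P₃, h₃, P₄, h₄, rfl⟩ := exists_combination hA
  rw [I_smul_combination, ext_combination h₁ h₂ h₃ h₄, ext_combination h₄ h₃ h₁ h₂]
  linear_combination (-(φ.val P₃ : ℂ) + φ.val P₄) * Complex.I_mul_I

theorem sub_mem_domain (hA : A ∈ φ.domain) (hB : B ∈ φ.domain) : A - B ∈ φ.domain := by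
  rw [sub_eq_add_neg]
  exact add_mem_domain hA (neg_mem_domain hB)

theorem ext_sub (hA : A ∈ φ.domain) (hB : B ∈ φ.domain) : φ.ext (A - B) = φ.ext A - φ.ext B := by
  rw [sub_eq_add_neg, ext_add hA (neg_mem_domain hB), ext_neg hB, sub_eq_add_neg]

variable {A₁ A₂ A₃ A₄ : H →L[ℂ] H}

theorem jordan_combination_mem_domain (h₁ : A₁ ∈ φ.domain) (h₂ : A₂ ∈ φ.domain)
    (h₃ : A₃ ∈ φ.domain) (h₄ : A₄ ∈ φ.domain) :
    (A₁ - A₂) + Complex.I • (A₃ - A₄) ∈ φ.domain :=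
  add_mem_domain (sub_mem_domain h₁ h₂) (I_smul_mem_domain (sub_mem_domain h₃ h₄))

theorem ext_jordan_combination (h₁ : A₁ ∈ φ.domain) (h₂ : A₂ ∈ φ.domain) (h₃ : A₃ ∈ φ.domain)
    (h₄ : A₄ ∈ φ.domain) : φ.ext ((A₁ - A₂) + Complex.I • (A₃ - A₄)) =
      (φ.ext A₁ - φ.ext A₂) + Complex.I * (φ.ext A₃ - φ.ext A₄) := by
  rw [ext_add (sub_mem_domain h₁ h₂) (I_smul_mem_domain (sub_mem_domain h₃ h₄)),
    ext_I_smul (sub_mem_domain h₃ h₄), ext_sub h₁ h₂, ext_sub h₃ h₄]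

end Linear

section Ideal

variable {X Z : H →L[ℂ] H}

theorem polarVec_mem_vonNeumann (hX : X ∈ N) (hZ : Z ∈ N) (c : ℂ) : polarVec X Z c ∈ N :=
  complex_smul_mem_vonNeumann _ (AddMemClass.add_mem hX (complex_smul_mem_vonNeumann c hZ))

theorem star_polarVec_mul_self_mem (hX : X ∈ N) (hZ : Z ∈ N) (hXX : star X * X ∈ φ.cone)
    (hZZ : star Z * Z ∈ φ.cone) {c : ℂ} (hc : ‖c‖ = 1) :
    star (polarVec X Z c) * polarVec X Z c ∈ φ.cone :=
  have hN := polarVec_mem_vonNeumann hX hZ c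
  mem_of_le (φ.add_mem _ hXX _ hZZ) (mul_mem (star_mem hN) hN) (star_mul_self_nonneg _)
    (star_polarVec_mul_self_le X Z hc)

theorem star_mul_mem_domain (hX : X ∈ N) (hZ : Z ∈ N) (hXX : star X * X ∈ φ.cone)
    (hZZ : star Z * Z ∈ φ.cone) : star X * Z ∈ φ.domain := by
  have hmem (c : ℂ) (hc : ‖c‖ = 1) := star_polarVec_mul_self_mem hX hZ hXX hZZ hc
  rw [star_mul_eq_polarization]
  exact combination_mem (hmem 1 (by simp)) (hmem (-1) (by simp)) (hmem (-Complex.I) (by simp))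
    (hmem Complex.I (by simp))

theorem ext_star_mul_comm (hX : X ∈ N) (hZ : Z ∈ N) (hXX : star X * X ∈ φ.cone)
    (hZZ : star Z * Z ∈ φ.cone) : φ.ext (star X * Z) = φ.ext (Z * star X) := by
  have hN (c : ℂ) := polarVec_mem_vonNeumann hX hZ c
  have hmem (c : ℂ) (hc : ‖c‖ = 1) := star_polarVec_mul_self_mem hX hZ hXX hZZ hc
  have hmem' (c : ℂ) (hc : ‖c‖ = 1) := φ.swap_mem _ (hN c) (hmem c hc)
  have hval (c : ℂ) (hc : ‖c‖ = 1) := φ.val_swap _ (hN c) (hmem c hc)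
  rw [star_mul_eq_polarization, mul_star_eq_polarization,
    ext_combination (hmem 1 (by simp)) (hmem (-1) (by simp)) (hmem (-Complex.I) (by simp))
      (hmem Complex.I (by simp)),
    ext_combination (hmem' 1 (by simp)) (hmem' (-1) (by simp)) (hmem' (-Complex.I) (by simp))
      (hmem' Complex.I (by simp)),
    hval 1 (by simp), hval (-1) (by simp), hval (-Complex.I) (by simp), hval Complex.I (by simp)]

variable {P b : H →L[ℂ] H}

theorem sqrt_conj_mem (hP : P ∈ φ.cone) (hb : b ∈ N) (hb0 : 0 ≤ b) :
    CFC.sqrt P * b * CFC.sqrt P ∈ φ.cone := by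
  have hs := sqrt_mem_vonNeumann (φ.mem_alg P hP)
  obtain ⟨n, hn⟩ := exists_nat_ge ‖b‖
  refine mem_of_le (nsmul_mem hP n) (mul_mem (mul_mem hs hb) hs) (sqrt_conj_nonneg P hb0) ?_
  calc CFC.sqrt P * b * CFC.sqrt P
      ≤ CFC.sqrt P * (n : H →L[ℂ] H) * CFC.sqrt P :=
        sqrt_conj_mono P ((CStarAlgebra.norm_le_natCast_iff_of_nonneg b n hb0).1 hn)
    _ = n • P := by
        rw [← (Nat.cast_commute n (CFC.sqrt P)).eq, mul_assoc,
          CFC.sqrt_mul_sqrt_self P (φ.nonneg P hP), nsmul_eq_mul]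

theorem star_sqrt_mul_sqrt_mem (hP : P ∈ φ.cone) : star (CFC.sqrt P) * CFC.sqrt P ∈ φ.cone := by
  rwa [(CFC.sqrt_nonneg P).isSelfAdjoint.star_eq, CFC.sqrt_mul_sqrt_self P (φ.nonneg P hP)]

theorem star_sqrt_mul_mul_sqrt_mul_mem (hP : P ∈ φ.cone) (hb : b ∈ N) :
    star (CFC.sqrt P * b) * (CFC.sqrt P * b) ∈ φ.cone := by
  have hsN := sqrt_mem_vonNeumann (φ.mem_alg P hP)
  have hswap : star (star (CFC.sqrt P * b)) * star (CFC.sqrt P * b) =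
      CFC.sqrt P * (b * star b) * CFC.sqrt P := by
    rw [star_star, star_mul, (CFC.sqrt_nonneg P).isSelfAdjoint.star_eq]
    noncomm_ring
  simpa only [star_star] using φ.swap_mem _ (star_mem (mul_mem hsN hb))
    (hswap ▸ sqrt_conj_mem hP (mul_mem hb (star_mem hb)) (mul_star_self_nonneg b))

theorem sqrt_mul_sqrt_mul (hP : P ∈ φ.cone) (b : H →L[ℂ] H) :
    star (CFC.sqrt P) * (CFC.sqrt P * b) = P * b := by
  rw [(CFC.sqrt_nonneg P).isSelfAdjoint.star_eq, ← mul_assoc,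
    CFC.sqrt_mul_sqrt_self P (φ.nonneg P hP)]

theorem mul_mem_domain_of_mem_cone (hP : P ∈ φ.cone) (hb : b ∈ N) : P * b ∈ φ.domain := by
  have hsN := sqrt_mem_vonNeumann (φ.mem_alg P hP)
  rw [← sqrt_mul_sqrt_mul hP]
  exact star_mul_mem_domain hsN (mul_mem hsN hb) (star_sqrt_mul_sqrt_mem hP)
    (star_sqrt_mul_mul_sqrt_mul_mem hP hb)

theorem ext_mul_of_nonneg (hP : P ∈ φ.cone) (hb : b ∈ N) (hb0 : 0 ≤ b) :
    φ.ext (P * b) = φ.val (CFC.sqrt P * b * CFC.sqrt P) := by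
  have hsN := sqrt_mem_vonNeumann (φ.mem_alg P hP)
  rw [← sqrt_mul_sqrt_mul hP, ext_star_mul_comm hsN (mul_mem hsN hb) (star_sqrt_mul_sqrt_mem hP)
    (star_sqrt_mul_mul_sqrt_mul_mem hP hb), (CFC.sqrt_nonneg P).isSelfAdjoint.star_eq,
    ext_of_mem (sqrt_conj_mem hP hb hb0)]

variable {A B : H →L[ℂ] H}

theorem ext_mul_of_mem_cone (hP : P ∈ φ.cone) (hB : B ∈ N) :
    φ.ext (P * B) = jordanExtend (fun b => (φ.val (CFC.sqrt P * b * CFC.sqrt P) : ℂ)) B := by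
  have hre := realPart_mem_vonNeumann hB
  have him := imaginaryPart_mem_vonNeumann hB
  rw [mul_eq_jordan_right, ext_jordan_combination
    (mul_mem_domain_of_mem_cone hP (posPart_mem_vonNeumann hre))
    (mul_mem_domain_of_mem_cone hP (negPart_mem_vonNeumann hre))
    (mul_mem_domain_of_mem_cone hP (posPart_mem_vonNeumann him))
    (mul_mem_domain_of_mem_cone hP (negPart_mem_vonNeumann him)),
    ext_mul_of_nonneg hP (posPart_mem_vonNeumann hre) (CFC.posPart_nonneg _),
    ext_mul_of_nonneg hP (negPart_mem_vonNeumann hre) (CFC.negPart_nonneg _),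
    ext_mul_of_nonneg hP (posPart_mem_vonNeumann him) (CFC.posPart_nonneg _),
    ext_mul_of_nonneg hP (negPart_mem_vonNeumann him) (CFC.negPart_nonneg _)]
  rfl

theorem ext_mul (hA : A ∈ φ.domain) (hB : B ∈ N) :
    φ.ext (A * B) = jordanExtend (fun P => φ.ext (P * B)) A := by
  rw [mul_eq_jordan_left, ext_jordan_combination (mul_mem_domain_of_mem_cone hA.2.1 hB)
    (mul_mem_domain_of_mem_cone hA.2.2.1 hB) (mul_mem_domain_of_mem_cone hA.2.2.2.1 hB)
    (mul_mem_domain_of_mem_cone hA.2.2.2.2 hB)]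
  rfl

end Ideal

end TracialFunctional

end TracialFunctional

section DyadicSums

theorem sum_range_one_sub_mul_pow_mul {r : ℝ} (h1 : r < 1) (K : ℕ) :
    ∑ k ∈ Finset.range K, (r ^ k - r ^ (k + 1)) * (k + 2) + r ^ K * (K + 1 + (1 - r)⁻¹) =
      1 + (1 - r)⁻¹ := by
  have hr : 1 - r ≠ 0 := by linarith
  induction K with
  | zero => simp
  | succ K ih =>
    rw [Finset.sum_range_succ, ← ih]
    push_cast
    field_simp
    ring

theorem sum_range_pow_sub_pow_succ_mul_le {r : ℝ} (h0 : 0 ≤ r) (h1 : r < 1) (K : ℕ) :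
    ∑ k ∈ Finset.range K, (r ^ k - r ^ (k + 1)) * (k + 2) ≤ 1 + (1 - r)⁻¹ := by
  have : 0 < 1 - r := sub_pos.2 h1
  have hrem : 0 ≤ r ^ K * (K + 1 + (1 - r)⁻¹) := by positivity
  linarith [sum_range_one_sub_mul_pow_mul h1 K]

theorem pow_succ_le_pow {r : ℝ} (h0 : 0 ≤ r) (h1 : r ≤ 1) (k : ℕ) : r ^ (k + 1) ≤ r ^ k :=
  pow_le_pow_of_le_one h0 h1 k.le_succ

theorem mul_rpow_sub_le_sum_posPart {s x : ℝ} (hs : 0 < s) (hx : 0 ≤ x) (hx1 : x ≤ 1) (K : ℕ) :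
    x * ((x / 2) ^ s - ((1 / 2 : ℝ) ^ s) ^ K) ≤
      ∑ k ∈ Finset.range K, 2 * (((1 / 2 : ℝ) ^ s) ^ k - ((1 / 2 : ℝ) ^ s) ^ (k + 1)) *
        max (x - (1 / 2) ^ (k + 1)) 0 := by
  set r : ℝ := (1 / 2 : ℝ) ^ s with hr
  have r0 : 0 ≤ r := by positivity
  have r1 : r ≤ 1 := Real.rpow_le_one (by norm_num) (by norm_num) hs.le
  have hdiff (k : ℕ) : 0 ≤ r ^ k - r ^ (k + 1) := sub_nonneg.2 (pow_succ_le_pow r0 r1 k)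
  induction K with
  | zero =>
    have hxs : (x / 2) ^ s ≤ 1 := Real.rpow_le_one (by positivity) (by linarith) hs.le
    rw [pow_zero, Finset.range_zero, Finset.sum_empty]
    exact mul_nonpos_of_nonneg_of_nonpos hx (by linarith)
  | succ K ih =>
    rcases le_total ((1 / 2 : ℝ) ^ K) x with hKx | hxK
    · have hhalf : x / 2 ≤ max (x - (1 / 2 : ℝ) ^ (K + 1)) 0 := by
        refine le_max_of_le_left ?_
        rw [pow_succ]
        linarith
      rw [Finset.sum_range_succ]
      nlinarith [mul_le_mul_of_nonneg_left hhalf (hdiff K)]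
    · have hpow : (x / 2) ^ s ≤ r ^ (K + 1) := by
        rw [hr, ← Real.rpow_natCast, ← Real.rpow_mul (by norm_num), mul_comm s,
          Real.rpow_mul (by norm_num), Real.rpow_natCast]
        refine Real.rpow_le_rpow (by positivity) ?_ hs.le
        rw [pow_succ]
        linarith
      calc x * ((x / 2) ^ s - r ^ (K + 1)) ≤ 0 :=
            mul_nonpos_of_nonneg_of_nonpos hx (sub_nonpos.2 hpow)
        _ ≤ _ := Finset.sum_nonneg fun k _ =>
            mul_nonneg (mul_nonneg zero_le_two (hdiff k)) (le_max_right _ _)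

theorem half_le_one_half_rpow {s : ℝ} (hs1 : s ≤ 1) : 1 / 2 ≤ (1 / 2 : ℝ) ^ s := by
  simpa only [Real.rpow_one] using
    Real.rpow_le_rpow_of_exponent_ge (x := (1 / 2 : ℝ)) (by norm_num) (by norm_num) hs1

theorem half_le_one_sub_one_half_rpow {s : ℝ} (hs : 0 ≤ s) (hs1 : s ≤ 1) :
    s / 2 ≤ 1 - (1 / 2 : ℝ) ^ s := by
  have hBernoulli := rpow_one_add_le_one_add_mul_self (s := -(1 / 2)) (by norm_num) hs hs1
  norm_num at hBernoulli ⊢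
  linarith

end DyadicSums

section DyadicOperatorSums

variable {A : Type*} [CStarAlgebra A] [PartialOrder A] [StarOrderedRing A] {Q : A}

theorem cfc_mul_rpow_sub_le_sum (hQ : 0 ≤ Q) (hQ1 : Q ≤ 1) {s : ℝ} (hs : 0 < s) (K : ℕ) :
    cfc (fun x : ℝ => max (x * ((x / 2) ^ s - ((1 / 2 : ℝ) ^ s) ^ K)) 0) Q ≤
      ∑ k ∈ Finset.range K, (2 * (((1 / 2 : ℝ) ^ s) ^ k - ((1 / 2 : ℝ) ^ s) ^ (k + 1))) •
        (Q - algebraMap ℝ A ((1 / 2) ^ (k + 1)))⁺ := by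
  set r : ℝ := (1 / 2 : ℝ) ^ s
  have r0 : 0 ≤ r := by positivity
  have r1 : r ≤ 1 := Real.rpow_le_one (by norm_num) (by norm_num) hs.le
  have hdiff (k : ℕ) : 0 ≤ 2 * (r ^ k - r ^ (k + 1)) :=
    mul_nonneg zero_le_two (sub_nonneg.2 (pow_succ_le_pow r0 r1 k))
  have hcs : Continuous fun x : ℝ => (x / 2) ^ s :=
    (Real.continuous_rpow_const hs.le).comp (by fun_prop)
  have hsummand (k : ℕ) : (2 * (r ^ k - r ^ (k + 1))) • (Q - algebraMap ℝ A ((1 / 2) ^ (k + 1)))⁺ =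
      cfc (fun x : ℝ => 2 * (r ^ k - r ^ (k + 1)) * max (x - (1 / 2) ^ (k + 1)) 0) Q := by
    rw [posPart_sub_algebraMap_eq_cfc hQ.isSelfAdjoint, cfc_const_mul _ _ Q]
  rw [Finset.sum_congr rfl fun k _ => hsummand k, ← cfc_sum
    (fun (k : ℕ) (x : ℝ) => 2 * (r ^ k - r ^ (k + 1)) * max (x - (1 / 2) ^ (k + 1)) 0)
    Q (Finset.range K) fun k _ => by fun_prop]
  refine cfc_mono (fun x hx => ?_) (by fun_prop) ?_
  · rw [Finset.sum_apply]
    exact max_le (mul_rpow_sub_le_sum_posPart hs (spectrum_nonneg_of_nonneg hQ hx)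
      ((CFC.le_one_iff (R := ℝ) Q).1 hQ1 x hx) K)
      (Finset.sum_nonneg fun k _ => mul_nonneg (hdiff k) (le_max_right _ _))
  · simp only [Finset.sum_fn]
    fun_prop

theorem rpow_eq_smul_cfc_mul_half_rpow (hQ : 0 ≤ Q) {s : ℝ} (hs : 0 < s) :
    Q ^ (1 + s) = ((1 / 2 : ℝ) ^ s)⁻¹ • cfc (fun x : ℝ => x * (x / 2) ^ s) Q := by
  have hcs : Continuous fun x : ℝ => (x / 2) ^ s :=
    (Real.continuous_rpow_const hs.le).comp (by fun_prop)
  rw [CFC.rpow_eq_cfc_real hQ, ← cfc_const_mul _ (fun x : ℝ => x * (x / 2) ^ s) Q (by fun_prop)]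
  refine cfc_congr fun x hx => ?_
  have hx0 : 0 ≤ x := spectrum_nonneg_of_nonneg hQ hx
  have hr : (1 / 2 : ℝ) ^ s ≠ 0 := by positivity
  change x ^ (1 + s) = ((1 / 2 : ℝ) ^ s)⁻¹ * (x * (x / 2) ^ s)
  rw [Real.rpow_add_of_nonneg hx0 zero_le_one hs.le, Real.rpow_one, div_eq_mul_one_div x,
    Real.mul_rpow hx0 (by norm_num)]
  field_simp

theorem posPart_sub_algebraMap_le {X : A} (hX : IsSelfAdjoint X) {c : ℝ} (hc : 0 ≤ c) :
    X⁺ - algebraMap ℝ A c ≤ (X - algebraMap ℝ A c)⁺ := by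
  rw [posPart_sub_algebraMap_eq_cfc hX, CFC.posPart_def, cfcₙ_eq_cfc, ← cfc_const c X,
    ← cfc_sub (fun x : ℝ => x⁺) (fun _ => c) X]
  refine cfc_mono fun x _ => ?_
  rw [posPart_def]
  change max x 0 - c ≤ max (x - c) 0
  rw [← max_sub_sub_right]
  exact max_le_max le_rfl (by linarith)

end DyadicOperatorSums

section LogCone

variable {H : Type*} [NormedAddCommGroup H] [InnerProductSpace ℂ H] [CompleteSpace H]

namespace FNSTrace

variable {N : VonNeumannAlgebra H} (τ : FNSTrace N)

theorem posPart_mono {X Y : H →L[ℂ] H} (hX : X ∈ N) (hY : Y ∈ N) (hXs : IsSelfAdjoint X)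
    (hYs : IsSelfAdjoint Y) (hXY : X ≤ Y) : τ.toFun X⁺ ≤ τ.toFun Y⁺ :=
  τ.posPart_le hX (posPart_mem_vonNeumann hY) hXs (CFC.posPart_nonneg Y)
    (hXY.trans (CFC.le_posPart hYs))

theorem posPart_add_le {X Y : H →L[ℂ] H} (hX : X ∈ N) (hY : Y ∈ N) (hXs : IsSelfAdjoint X)
    (hYs : IsSelfAdjoint Y) : τ.toFun (X + Y)⁺ ≤ τ.toFun X⁺ + τ.toFun Y⁺ := by
  have hXN := posPart_mem_vonNeumann hX
  have hYN := posPart_mem_vonNeumann hY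
  rw [← τ.map_add' _ hXN _ hYN (CFC.posPart_nonneg _) (CFC.posPart_nonneg _)]
  exact τ.posPart_le (AddMemClass.add_mem hX hY) (AddMemClass.add_mem hXN hYN) (hXs.add hYs)
    (add_nonneg (CFC.posPart_nonneg _) (CFC.posPart_nonneg _))
    (add_le_add (CFC.le_posPart hXs) (CFC.le_posPart hYs))

theorem posPart_sub_swap {X : H →L[ℂ] H} (hX : X ∈ N) {c : ℝ} (hc : 0 < c) :
    τ.toFun (star X * X - algebraMap ℝ (H →L[ℂ] H) c)⁺ =
      τ.toFun (X * star X - algebraMap ℝ (H →L[ℂ] H) c)⁺ := by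
  have hfactor : (fun x : ℝ => max (x - c) 0) = fun x => x * (max (x - c) 0 / max x c) := by
    ext x
    rcases le_total x c with h | h
    · simp [max_eq_right (sub_nonpos.2 h)]
    · rw [max_eq_left h, mul_div_cancel₀ _ (hc.trans_le h).ne']
  have hmax (x : ℝ) : 0 < max x c := lt_max_of_lt_right hc
  rw [posPart_sub_algebraMap_eq_cfc (.star_mul_self X),
    posPart_sub_algebraMap_eq_cfc (.mul_star_self X), hfactor]
  exact τ.cfc_star_mul_self hX (Continuous.div (by fun_prop) (by fun_prop) fun x => (hmax x).ne')
    fun x => div_nonneg (le_max_right _ _) (hmax x).le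

theorem rpow_swap {X : H →L[ℂ] H} (hX : X ∈ N) {s : ℝ} (hs : 0 < s) :
    τ.toFun ((star X * X) ^ (1 + s)) = τ.toFun ((X * star X) ^ (1 + s)) := by
  have hfactor {a : H →L[ℂ] H} (ha : 0 ≤ a) :
      a ^ (1 + s) = cfc (fun x : ℝ => x * (max x 0) ^ s) a := by
    rw [CFC.rpow_eq_cfc_real ha]
    refine cfc_congr fun x hx => ?_
    have hx0 : 0 ≤ x := spectrum_nonneg_of_nonneg ha hx
    change x ^ (1 + s) = x * (max x 0) ^ s
    rw [max_eq_left hx0, Real.rpow_add_of_nonneg hx0 zero_le_one hs.le, Real.rpow_one]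
  rw [hfactor (star_mul_self_nonneg X), hfactor (mul_star_self_nonneg X)]
  exact τ.cfc_star_mul_self hX ((Real.continuous_rpow_const hs.le).comp (by fun_prop))
    fun x => by positivity

/-- The cone of positive operators of `N` whose truncated traces `τ((P - 2⁻ᵏ)₊)` grow at most
linearly in `k`. It contains the positive part of `M_{1,∞}`, and its powers of exponent `1 + s`
have trace `O(1 / s)`. -/
def logCone : Set (H →L[ℂ] H) :=
  {P | P ∈ N ∧ 0 ≤ P ∧ ∃ C : NNReal, ∀ k : ℕ,
    τ.toFun (P - algebraMap ℝ (H →L[ℂ] H) ((1 / 2) ^ k))⁺ ≤ C * (k + 1)}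

variable {τ} {P Q : H →L[ℂ] H}

theorem zero_mem_logCone : 0 ∈ τ.logCone := by
  refine ⟨zero_mem N, le_rfl, 0, fun k => ?_⟩
  have hk : 0 ≤ algebraMap ℝ (H →L[ℂ] H) ((1 / 2) ^ k) := algebraMap_nonneg _ (by positivity)
  rw [zero_sub, (CFC.posPart_eq_zero_iff _ (hk.isSelfAdjoint.neg)).2 (neg_nonpos.2 hk), τ.map_zero]
  exact zero_le

theorem add_mem_logCone (hP : P ∈ τ.logCone) (hQ : Q ∈ τ.logCone) : P + Q ∈ τ.logCone := by
  obtain ⟨hPN, hP0, C, hC⟩ := hP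
  obtain ⟨hQN, hQ0, D, hD⟩ := hQ
  refine ⟨add_mem hPN hQN, add_nonneg hP0 hQ0, 2 * (C + D), fun k => ?_⟩
  set u := algebraMap ℝ (H →L[ℂ] H) ((1 / 2) ^ (k + 1)) with hu
  have hus : IsSelfAdjoint u := .algebraMap _ (.all _)
  have huN : u ∈ N := algebraMap_real_mem_vonNeumann _
  have hsplit : P + Q - algebraMap ℝ (H →L[ℂ] H) ((1 / 2) ^ k) = (P - u) + (Q - u) := by
    have huu : algebraMap ℝ (H →L[ℂ] H) ((1 / 2) ^ k) = u + u := by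
      rw [hu, ← _root_.map_add]
      congr 1
      ring
    rw [huu]
    abel
  have hk : (((k + 1 : ℕ) : ℝ≥0∞) + 1) ≤ 2 * (k + 1) := by
    norm_cast
    omega
  calc τ.toFun (P + Q - algebraMap ℝ (H →L[ℂ] H) ((1 / 2) ^ k))⁺
      ≤ τ.toFun (P - u)⁺ + τ.toFun (Q - u)⁺ := hsplit ▸ τ.posPart_add_le (sub_mem hPN huN)
        (sub_mem hQN huN) (hP0.isSelfAdjoint.sub hus) (hQ0.isSelfAdjoint.sub hus)
    _ ≤ C * (((k + 1 : ℕ) : ℝ≥0∞) + 1) + D * (((k + 1 : ℕ) : ℝ≥0∞) + 1) :=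
        add_le_add (hC (k + 1)) (hD (k + 1))
    _ = (C + D) * (((k + 1 : ℕ) : ℝ≥0∞) + 1) := by ring
    _ ≤ (C + D) * (2 * (k + 1)) := by gcongr
    _ = _ := by push_cast; ring

theorem posPart_mem_logCone {X : H →L[ℂ] H} (hP : P ∈ τ.logCone) (hX : X ∈ N)
    (hXs : IsSelfAdjoint X) (hXP : X ≤ P) : X⁺ ∈ τ.logCone := by
  obtain ⟨hPN, hP0, C, hC⟩ := hP
  refine ⟨posPart_mem_vonNeumann hX, CFC.posPart_nonneg _, C, fun k => ?_⟩
  set u := algebraMap ℝ (H →L[ℂ] H) ((1 / 2) ^ k)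
  have hus : IsSelfAdjoint u := .algebraMap _ (.all _)
  have huN : u ∈ N := algebraMap_real_mem_vonNeumann _
  calc τ.toFun (X⁺ - u)⁺
      ≤ τ.toFun (X - u)⁺ := τ.posPart_le (sub_mem (posPart_mem_vonNeumann hX) huN)
        (posPart_mem_vonNeumann (sub_mem hX huN)) ((CFC.posPart_nonneg X).isSelfAdjoint.sub hus)
        (CFC.posPart_nonneg _) (posPart_sub_algebraMap_le hXs (by positivity))
    _ ≤ τ.toFun (P - u)⁺ := τ.posPart_mono (sub_mem hX huN) (sub_mem hPN huN) (hXs.sub hus)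
        (hP0.isSelfAdjoint.sub hus) (sub_le_sub_right hXP u)
    _ ≤ C * (k + 1) := hC k

theorem mem_logCone_of_le (hP : P ∈ τ.logCone) (hQ : Q ∈ N) (h0 : 0 ≤ Q) (h : Q ≤ P) :
    Q ∈ τ.logCone := by
  simpa only [(CFC.posPart_eq_self Q).2 h0] using posPart_mem_logCone hP hQ h0.isSelfAdjoint h

theorem swap_mem_logCone {X : H →L[ℂ] H} (hX : X ∈ N) (h : star X * X ∈ τ.logCone) :
    X * star X ∈ τ.logCone := by
  obtain ⟨-, -, C, hC⟩ := h
  refine ⟨mul_mem hX (star_mem hX), mul_star_self_nonneg X, C, fun k => ?_⟩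
  rw [← τ.posPart_sub_swap hX (by positivity)]
  exact hC k

theorem trace_sum_smul_posPart_le (hQ : Q ∈ N) {C : NNReal}
    (hC : ∀ k : ℕ, τ.toFun (Q - algebraMap ℝ (H →L[ℂ] H) ((1 / 2) ^ k))⁺ ≤ C * (k + 1))
    {r : ℝ} (h0 : 0 ≤ r) (h1 : r < 1) (K : ℕ) :
    τ.toFun (∑ k ∈ Finset.range K, (2 * (r ^ k - r ^ (k + 1))) •
        (Q - algebraMap ℝ (H →L[ℂ] H) ((1 / 2) ^ (k + 1)))⁺) ≤
      ENNReal.ofReal (2 * C * (1 + (1 - r)⁻¹)) := by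
  have hdiff (k : ℕ) : 0 ≤ r ^ k - r ^ (k + 1) := sub_nonneg.2 (pow_succ_le_pow h0 h1.le k)
  have hcoeff (k : ℕ) : 0 ≤ 2 * (r ^ k - r ^ (k + 1)) := mul_nonneg zero_le_two (hdiff k)
  have hN (k : ℕ) : (Q - algebraMap ℝ (H →L[ℂ] H) ((1 / 2) ^ (k + 1)))⁺ ∈ N :=
    posPart_mem_vonNeumann (sub_mem hQ (algebraMap_real_mem_vonNeumann _))
  have hC' (k : ℕ) : τ.toFun (Q - algebraMap ℝ (H →L[ℂ] H) ((1 / 2) ^ (k + 1)))⁺ ≤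
      ENNReal.ofReal (C * (k + 2)) := by
    refine (hC (k + 1)).trans_eq ?_
    rw [ENNReal.ofReal_mul C.coe_nonneg, ENNReal.ofReal_coe_nnreal]
    norm_cast
  rw [τ.map_sum _ (fun k _ => real_smul_mem_vonNeumann _ (hN k))
    fun k _ => smul_nonneg (hcoeff k) (CFC.posPart_nonneg _)]
  calc ∑ k ∈ Finset.range K, τ.toFun ((2 * (r ^ k - r ^ (k + 1))) •
        (Q - algebraMap ℝ (H →L[ℂ] H) ((1 / 2) ^ (k + 1)))⁺)
      ≤ ∑ k ∈ Finset.range K, ENNReal.ofReal (2 * C * ((r ^ k - r ^ (k + 1)) * (k + 2))) := by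
        refine Finset.sum_le_sum fun k _ => ?_
        rw [τ.map_smul' _ (hcoeff k) _ (hN k) (CFC.posPart_nonneg _)]
        refine (mul_le_mul_right (hC' k) _).trans_eq ?_
        rw [← ENNReal.ofReal_mul (hcoeff k)]
        congr 1
        ring
    _ = ENNReal.ofReal (2 * C * ∑ k ∈ Finset.range K, (r ^ k - r ^ (k + 1)) * (k + 2)) := by
        rw [Finset.mul_sum, ENNReal.ofReal_sum_of_nonneg]
        exact fun k _ => mul_nonneg (by positivity) (mul_nonneg (hdiff k) (by positivity))
    _ ≤ ENNReal.ofReal (2 * C * (1 + (1 - r)⁻¹)) := ENNReal.ofReal_le_ofReal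
        (mul_le_mul_of_nonneg_left (sum_range_pow_sub_pow_succ_mul_le h0 h1 K) (by positivity))

theorem trace_cfc_mul_half_rpow_le (hQ : Q ∈ N) (hQ0 : 0 ≤ Q) (hQ1 : Q ≤ 1) {C : NNReal}
    (hC : ∀ k : ℕ, τ.toFun (Q - algebraMap ℝ (H →L[ℂ] H) ((1 / 2) ^ k))⁺ ≤ C * (k + 1))
    {s : ℝ} (hs : 0 < s) :
    τ.toFun (cfc (fun x : ℝ => x * (x / 2) ^ s) Q) ≤
      ENNReal.ofReal (2 * C * (1 + (1 - (1 / 2 : ℝ) ^ s)⁻¹)) := by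
  set r : ℝ := (1 / 2 : ℝ) ^ s
  have r0 : 0 ≤ r := by positivity
  have r1 : r < 1 := Real.rpow_lt_one (by norm_num) (by norm_num) hs
  have hcs : Continuous fun x : ℝ => (x / 2) ^ s :=
    (Real.continuous_rpow_const hs.le).comp (by fun_prop)
  have hspec (x : ℝ) (hx : x ∈ spectrum ℝ Q) : 0 ≤ x ∧ x ≤ 1 :=
    ⟨spectrum_nonneg_of_nonneg hQ0 hx, (CFC.le_one_iff (R := ℝ) Q).1 hQ1 x hx⟩
  refine τ.cfc_le_of_tendsto hQ (h := fun K x => max (x * ((x / 2) ^ s - r ^ K)) 0)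
    (ε := fun K => r ^ K) (fun K => by fun_prop) (by fun_prop) (fun K x _ => le_max_right _ _)
    ?mono (tendsto_pow_atTop_nhds_zero_of_lt_one r0 r1) (fun K => by positivity) ?dist ?trace
  case mono =>
    intro K x hx
    exact max_le_max (mul_le_mul_of_nonneg_left (sub_le_sub_left (pow_succ_le_pow r0 r1.le K) _)
      (hspec x hx).1) le_rfl
  case dist =>
    intro K x hx
    obtain ⟨hx0, hx1⟩ := hspec x hx
    have hxK : x * r ^ K ≤ r ^ K := mul_le_of_le_one_left (by positivity) hx1
    have hxK0 : 0 ≤ x * r ^ K := by positivity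
    have hxs : 0 ≤ x * (x / 2) ^ s := by positivity
    rw [mul_sub, abs_le]
    rcases max_cases (x * (x / 2) ^ s - x * r ^ K) 0 with h | h <;> constructor <;> linarith
  case trace =>
    intro K
    refine (τ.mono (cfc_mem_vonNeumann hQ _) (sum_mem fun k _ => real_smul_mem_vonNeumann _
      (posPart_mem_vonNeumann (sub_mem hQ (algebraMap_real_mem_vonNeumann _))))
      (cfc_nonneg fun x _ => le_max_right _ _) (cfc_mul_rpow_sub_le_sum hQ0 hQ1 hs K)).trans ?_
    exact trace_sum_smul_posPart_le hQ hC r0 r1 K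

theorem trace_rpow_le_of_le_one (hQ : Q ∈ N) (hQ0 : 0 ≤ Q) (hQ1 : Q ≤ 1) {C : NNReal}
    (hC : ∀ k : ℕ, τ.toFun (Q - algebraMap ℝ (H →L[ℂ] H) ((1 / 2) ^ k))⁺ ≤ C * (k + 1))
    {s : ℝ} (hs : 0 < s) (hs1 : s ≤ 1) :
    τ.toFun (Q ^ (1 + s)) ≤ ENNReal.ofReal (16 * C / s) := by
  have hcfc : 0 ≤ cfc (fun x : ℝ => x * (x / 2) ^ s) Q := cfc_nonneg fun x hx => by
    have hx0 : 0 ≤ x := spectrum_nonneg_of_nonneg hQ0 hx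
    positivity
  have hhalf := half_le_one_half_rpow hs1
  have hgap := half_le_one_sub_one_half_rpow hs.le hs1
  set r : ℝ := (1 / 2 : ℝ) ^ s
  have r0 : 0 < r := by positivity
  have r1 : 0 < 1 - r := by linarith
  have hinv : r⁻¹ ≤ 2 := (inv_le_comm₀ r0 two_pos).2 (by linarith)
  have hinv_gap : (1 - r)⁻¹ ≤ 2 / s := by
    rwa [inv_le_comm₀ r1 (by positivity), inv_div]
  have hone : 1 ≤ 2 / s := by rw [le_div_iff₀ hs]; linarith
  calc τ.toFun (Q ^ (1 + s))
      = ENNReal.ofReal r⁻¹ * τ.toFun (cfc (fun x : ℝ => x * (x / 2) ^ s) Q) := by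
        rw [rpow_eq_smul_cfc_mul_half_rpow hQ0 hs,
          τ.map_smul' _ (by positivity) _ (cfc_mem_vonNeumann hQ _) hcfc]
    _ ≤ ENNReal.ofReal r⁻¹ * ENNReal.ofReal (2 * C * (1 + (1 - r)⁻¹)) :=
        mul_le_mul_right (trace_cfc_mul_half_rpow_le hQ hQ0 hQ1 hC hs) _
    _ = ENNReal.ofReal (r⁻¹ * (2 * C * (1 + (1 - r)⁻¹))) := by
        rw [← ENNReal.ofReal_mul (by positivity)]
    _ ≤ ENNReal.ofReal (2 * (2 * C * (2 / s + 2 / s))) :=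
        ENNReal.ofReal_le_ofReal (by gcongr)
    _ = ENNReal.ofReal (16 * C / s) := by ring_nf

theorem exists_trace_rpow_le (hP : P ∈ τ.logCone) :
    ∃ K : ℝ, 0 ≤ K ∧ ∀ s : ℝ, 0 < s → s ≤ 1 →
      τ.toFun (P ^ (1 + s)) ≤ ENNReal.ofReal (K / s) := by
  have hP0 : 0 ≤ P := hP.2.1
  set c : ℝ := max ‖P‖ 1
  have hc1 : 1 ≤ c := le_max_right _ _
  have hc0 : 0 < c := by positivity
  set Q : H →L[ℂ] H := c⁻¹ • P with hQ
  have hQ0 : 0 ≤ Q := smul_nonneg (by positivity) hP0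
  have hQN : Q ∈ N := real_smul_mem_vonNeumann _ hP.1
  have hQP : Q ≤ P := smul_le_of_le_one_left hP0 (inv_le_one_of_one_le₀ hc1)
  have hQ1 : Q ≤ 1 := by
    rw [← CStarAlgebra.norm_le_one_iff_of_nonneg Q hQ0, hQ, norm_smul, Real.norm_of_nonneg
      (by positivity), inv_mul_le_iff₀ hc0, mul_one]
    exact le_max_left _ _
  obtain ⟨-, -, C, hC⟩ := mem_logCone_of_le hP hQN hQ0 hQP
  refine ⟨c ^ 2 * (16 * C), by positivity, fun s hs hs1 => ?_⟩
  have hPQ : P = c • Q := by rw [hQ, smul_smul, mul_inv_cancel₀ hc0.ne', one_smul]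
  have hcs : c ^ (1 + s) ≤ c ^ 2 := by
    rw [← Real.rpow_two]
    exact Real.rpow_le_rpow_of_exponent_le hc1 (by linarith)
  calc τ.toFun (P ^ (1 + s))
      = ENNReal.ofReal (c ^ (1 + s)) * τ.toFun (Q ^ (1 + s)) := by
        rw [hPQ, smul_rpow_of_nonneg hQ0 hc0.le (by positivity), τ.map_smul' _ (by positivity) _
          (rpow_mem_vonNeumann hQN _) CFC.rpow_nonneg]
    _ ≤ ENNReal.ofReal (c ^ 2) * ENNReal.ofReal (16 * C / s) := mul_le_mul'
        (ENNReal.ofReal_le_ofReal hcs) (trace_rpow_le_of_le_one hQN hQ0 hQ1 hC hs hs1)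
    _ = ENNReal.ofReal (c ^ 2 * (16 * C) / s) := by
        rw [← ENNReal.ofReal_mul (by positivity), mul_div_assoc, mul_div_assoc, mul_div_assoc]

theorem trace_rpow_lt_top (hP : P ∈ τ.logCone) {s : ℝ} (hs : 0 < s) :
    τ.toFun (P ^ (1 + s)) < ∞ := by
  have hP0 : 0 ≤ P := hP.2.1
  obtain ⟨K, -, hK⟩ := exists_trace_rpow_le hP
  rcases le_total s 1 with h | h
  · exact (hK s hs h).trans_lt ENNReal.ofReal_lt_top
  · have hle := rpow_le_smul_rpow hP0 hP0.isSelfAdjoint.le_algebraMap_norm_self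
      (show (0 : ℝ) < 1 + 1 by norm_num) (add_le_add_right h 1)
    refine (τ.mono (rpow_mem_vonNeumann hP.1 _)
      (real_smul_mem_vonNeumann _ (rpow_mem_vonNeumann hP.1 _)) CFC.rpow_nonneg hle).trans_lt ?_
    rw [τ.map_smul' _ (by positivity) _ (rpow_mem_vonNeumann hP.1 _) CFC.rpow_nonneg]
    exact ENNReal.mul_lt_top ENNReal.ofReal_lt_top
      ((hK 1 one_pos le_rfl).trans_lt ENNReal.ofReal_lt_top)

end FNSTrace

end LogCone

section SpectralProjections

variable {A : Type*} [CStarAlgebra A] [PartialOrder A] [StarOrderedRing A]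

theorem posPart_sub_algebraMap_antitone {a : A} (ha : IsSelfAdjoint a) :
    Antitone fun c : ℝ => (a - algebraMap ℝ A c)⁺ := by
  intro c b hcb
  simp only [posPart_sub_algebraMap_eq_cfc ha]
  exact cfc_mono (fun x _ => max_le_max (sub_le_sub_left hcb x) le_rfl) (by fun_prop)
    (by fun_prop)

theorem posPart_sub_algebraMap_sub_le {a : A} (ha : IsSelfAdjoint a) {b c : ℝ} (hcb : c ≤ b) :
    (a - algebraMap ℝ A c)⁺ - (a - algebraMap ℝ A b)⁺ ≤ algebraMap ℝ A (b - c) := by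
  rw [posPart_sub_algebraMap_eq_cfc ha, posPart_sub_algebraMap_eq_cfc ha,
    ← cfc_sub (fun x : ℝ => max (x - c) 0) (fun x : ℝ => max (x - b) 0) a]
  refine cfc_le_algebraMap _ _ a fun x _ => ?_
  rw [sub_le_iff_le_add]
  exact max_le (by linarith [le_max_left (x - b) 0]) (by linarith [le_max_right (x - b) 0])

theorem norm_abs_mul (a r : A) : ‖CFC.abs a * r‖ = ‖a * r‖ := by
  refine (mul_self_inj (norm_nonneg _) (norm_nonneg _)).1 ?_
  rw [← CStarRing.norm_star_mul_self, ← CStarRing.norm_star_mul_self, star_mul, star_mul,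
    (CFC.abs_nonneg a).isSelfAdjoint.star_eq]
  congr 1
  calc star r * CFC.abs a * (CFC.abs a * r) = star r * (CFC.abs a * CFC.abs a) * r := by
        simp only [mul_assoc]
    _ = star r * star a * (a * r) := by rw [CFC.abs_mul_abs]; simp only [mul_assoc]

theorem eq_zero_of_smul_le_conj_abs {a p r : A} {c : ℝ} (hr : IsStarProjection r)
    (hpr : p * r = r) (hcr : c • r ≤ r * CFC.abs a * r) (hc : ‖a * p‖ < c) : r = 0 := by
  have hc0 : 0 ≤ c := (norm_nonneg _).trans hc.le
  have h_le : c * ‖r‖ ≤ ‖a * p‖ * ‖r‖ := by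
    calc c * ‖r‖ = ‖c • r‖ := by rw [norm_smul, Real.norm_of_nonneg hc0]
      _ ≤ ‖r * (CFC.abs a * r)‖ := by
          rw [← mul_assoc]
          exact CStarAlgebra.norm_le_norm_of_nonneg_of_le (smul_nonneg hc0 hr.nonneg) hcr
      _ ≤ ‖r‖ * ‖CFC.abs a * r‖ := norm_mul_le _ _
      _ ≤ 1 * ‖CFC.abs a * r‖ := by gcongr; exact hr.norm_le
      _ = ‖a * p * r‖ := by rw [one_mul, norm_abs_mul, mul_assoc, hpr]
      _ ≤ ‖a * p‖ * ‖r‖ := norm_mul_le _ _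
  by_contra hr0
  exact hc.not_ge (le_of_mul_le_mul_right h_le (norm_pos_iff.2 hr0))

end SpectralProjections

section SingularValues

variable {H : Type*} [NormedAddCommGroup H] [InnerProductSpace ℂ H] [CompleteSpace H]

namespace FNSTrace

variable {N : VonNeumannAlgebra H} (τ : FNSTrace N)

theorem mu_le {t : ℝ} (A : H →L[ℂ] H) {p : H →L[ℂ] H} (hp : p ∈ N) (hpp : IsStarProjection p)
    (ht : τ.toFun (1 - p) ≤ ENNReal.ofReal t) : τ.mu t A ≤ ‖A * p‖ :=
  csInf_le ⟨0, by rintro _ ⟨p, -, -, -, rfl⟩; exact norm_nonneg _⟩ ⟨p, hp, hpp, ht, rfl⟩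

theorem le_mu {t r : ℝ} {A : H →L[ℂ] H} (h : ∀ p ∈ N, IsStarProjection p →
    τ.toFun (1 - p) ≤ ENNReal.ofReal t → r ≤ ‖A * p‖) : r ≤ τ.mu t A :=
  le_csInf ⟨_, 1, one_mem N, .one _, by simp [τ.map_zero], rfl⟩
    (by rintro _ ⟨p, hp, hpp, ht, rfl⟩; exact h p hp hpp ht)

theorem mu_nonneg (t : ℝ) (A : H →L[ℂ] H) : 0 ≤ τ.mu t A :=
  τ.le_mu fun _ _ _ _ => norm_nonneg _

theorem mu_antitone (A : H →L[ℂ] H) : Antitone fun t => τ.mu t A := fun _ _ hst =>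
  τ.le_mu fun _ hp hpp hs => τ.mu_le A hp hpp (hs.trans (ENNReal.ofReal_le_ofReal hst))

theorem exists_projection_of_mu_lt {t a : ℝ} {A : H →L[ℂ] H} (h : τ.mu t A < a) :
    ∃ p ∈ N, IsStarProjection p ∧ τ.toFun (1 - p) ≤ ENNReal.ofReal t ∧ ‖A * p‖ < a := by
  by_contra! h_ge
  exact h.not_ge (τ.le_mu fun p hp hpp ht => h_ge p hp hpp ht)

theorem exists_projection_mul_eq {p Y : H →L[ℂ] H} (hp : p ∈ N) (hpp : IsStarProjection p)
    (hY : Y ∈ N) :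
    ∃ q ∈ N, IsStarProjection q ∧ p * Y * q = Y * q ∧ τ.toFun (1 - q) ≤ τ.toFun (1 - p) := by
  have hZ : (1 - p) * Y ∈ N := mul_mem (sub_mem (one_mem N) hp) hY
  refine ⟨1 - rightSupport ((1 - p) * Y), sub_mem (one_mem N) (rightSupport_mem_vonNeumann hZ),
    (isStarProjection_rightSupport _).one_sub, ?_, ?_⟩
  · have h_zero : (1 - p) * Y * (1 - rightSupport ((1 - p) * Y)) = 0 := by
      rw [mul_sub, mul_rightSupport, mul_one, sub_self]
    rw [sub_mul, sub_mul, one_mul, sub_eq_zero] at h_zero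
    exact h_zero.symm
  · rw [sub_sub_cancel]
    exact τ.rightSupport_mul_le (sub_mem (one_mem N) hp) hpp.one_sub hY

theorem mu_star_le (t : ℝ) {A : H →L[ℂ] H} (hA : A ∈ N) : τ.mu t (star A) ≤ τ.mu t A := by
  refine τ.le_mu fun p hp hpp ht => ?_
  obtain ⟨q, hq, hqq, hpq, hle⟩ := τ.exists_projection_mul_eq hp hpp (star_mem hA)
  calc τ.mu t (star A) ≤ ‖star A * q‖ := τ.mu_le _ hq hqq (hle.trans ht)
    _ = ‖star (A * p) * q‖ := by rw [star_mul, hpp.isSelfAdjoint.star_eq, hpq]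
    _ ≤ ‖star (A * p)‖ * ‖q‖ := norm_mul_le _ _
    _ ≤ ‖star (A * p)‖ * 1 := by gcongr; exact hqq.norm_le
    _ = ‖A * p‖ := by rw [mul_one, norm_star]

theorem mu_mul_le (t : ℝ) (A : H →L[ℂ] H) {B : H →L[ℂ] H} (hB : B ∈ N) :
    τ.mu t (A * B) ≤ τ.mu t A * ‖B‖ := by
  refine le_mul_of_forall_lt₀ fun a ha b hb => ?_
  obtain ⟨p, hp, hpp, ht, hpa⟩ := τ.exists_projection_of_mu_lt ha
  obtain ⟨q, hq, hqq, hpq, hle⟩ := τ.exists_projection_mul_eq hp hpp hB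
  calc τ.mu t (A * B) ≤ ‖A * B * q‖ := τ.mu_le _ hq hqq (hle.trans ht)
    _ = ‖A * p * B * q‖ := by simp only [mul_assoc] at hpq ⊢; rw [hpq]
    _ ≤ ‖A * p‖ * ‖B‖ * ‖q‖ := norm_mul₃_le
    _ ≤ ‖A * p‖ * ‖B‖ * 1 := by gcongr; exact hqq.norm_le
    _ ≤ a * b := by
        rw [mul_one]
        exact mul_le_mul hpa.le hb.le (norm_nonneg B) ((norm_nonneg _).trans hpa.le)

theorem mu_add_le {s t : ℝ} (hs : 0 ≤ s) (ht : 0 ≤ t) (A B : H →L[ℂ] H) :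
    τ.mu (s + t) (A + B) ≤ τ.mu s A + τ.mu t B := by
  refine le_add_of_forall_lt fun a ha b hb => ?_
  obtain ⟨p, hp, hpp, hps, hpa⟩ := τ.exists_projection_of_mu_lt ha
  obtain ⟨q, hq, hqq, hqt, hqb⟩ := τ.exists_projection_of_mu_lt hb
  obtain ⟨r, hr, hrr, hpr, hqr, hle⟩ := τ.exists_projection_le_inf hp hpp hq hqq
  have hrp : r ≤ p := hrr.le_of_mul_eq_right hpp hpr
  have h_trace : τ.toFun (1 - r) ≤ ENNReal.ofReal (s + t) := by
    rw [← sub_add_sub_cancel 1 p r, τ.map_add' _ (sub_mem (one_mem N) hp) _ (sub_mem hp hr)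
      hpp.one_sub.nonneg (sub_nonneg.2 hrp), ENNReal.ofReal_add hs ht]
    exact add_le_add hps (hle.trans hqt)
  have h_bound {X e : H →L[ℂ] H} {x : ℝ} (her : e * r = r) (hx : ‖X * e‖ < x) : ‖X * r‖ ≤ x := by
    calc ‖X * r‖ = ‖X * e * r‖ := by rw [mul_assoc, her]
      _ ≤ ‖X * e‖ * 1 := norm_mul_le_of_le le_rfl hrr.norm_le
      _ ≤ x := by rw [mul_one]; exact hx.le
  calc τ.mu (s + t) (A + B) ≤ ‖(A + B) * r‖ := τ.mu_le _ hr hrr h_trace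
    _ ≤ ‖A * r‖ + ‖B * r‖ := by rw [add_mul]; exact norm_add_le _ _
    _ ≤ a + b := add_le_add (h_bound hpr hpa) (h_bound hqr hqb)

theorem intervalIntegrable_mu (A : H →L[ℂ] H) (a b : ℝ) :
    IntervalIntegrable (fun s => τ.mu s A) MeasureTheory.volume a b :=
  (τ.mu_antitone A).intervalIntegrable

theorem sub_mul_mu_le_integral {a b : ℝ} (hab : a ≤ b) (A : H →L[ℂ] H) :
    (b - a) * τ.mu b A ≤ ∫ s in a..b, τ.mu s A := by
  simpa using intervalIntegral.integral_mono_on hab (intervalIntegrable_const (c := τ.mu b A))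
    (τ.intervalIntegrable_mu A a b) fun s hs => τ.mu_antitone A hs.2

theorem integral_mu_add_le {t : ℝ} (ht : 0 ≤ t) (A B : H →L[ℂ] H) :
    ∫ s in (0 : ℝ)..t, τ.mu s (A + B) ≤
      2 * ((∫ s in (0 : ℝ)..t, τ.mu s A) + ∫ s in (0 : ℝ)..t, τ.mu s B) := by
  have h_int (X : H →L[ℂ] H) :
      IntervalIntegrable (fun s => τ.mu (s / 2) X) MeasureTheory.volume 0 t :=
    Antitone.intervalIntegrable fun _ _ h => τ.mu_antitone X (by gcongr)
  have h_half (X : H →L[ℂ] H) :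
      ∫ s in (0 : ℝ)..t, τ.mu (s / 2) X ≤ 2 * ∫ s in (0 : ℝ)..t, τ.mu s X := by
    rw [intervalIntegral.integral_comp_div (fun s => τ.mu s X) two_ne_zero, smul_eq_mul, zero_div]
    gcongr
    exact intervalIntegral.integral_mono_interval le_rfl (by positivity) (by linarith)
      (.of_forall fun s => τ.mu_nonneg s X) (τ.intervalIntegrable_mu X 0 t)
  calc ∫ s in (0 : ℝ)..t, τ.mu s (A + B)
      ≤ ∫ s in (0 : ℝ)..t, (τ.mu (s / 2) A + τ.mu (s / 2) B) := by
        refine intervalIntegral.integral_mono_on ht (τ.intervalIntegrable_mu _ _ _)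
          ((h_int A).add (h_int B)) fun s hs => ?_
        have hs0 : 0 ≤ s / 2 := div_nonneg hs.1 zero_le_two
        simpa only [add_halves] using τ.mu_add_le hs0 hs0 A B
    _ = (∫ s in (0 : ℝ)..t, τ.mu (s / 2) A) + ∫ s in (0 : ℝ)..t, τ.mu (s / 2) B :=
        intervalIntegral.integral_add (h_int A) (h_int B)
    _ ≤ _ := by linarith [h_half A, h_half B]

variable {τ}

theorem mem_M1Infty_iff {A : H →L[ℂ] H} : A ∈ τ.M1Infty ↔
    A ∈ N ∧ ∃ C, ∀ t : ℝ, 0 < t → ∫ s in (0 : ℝ)..t, τ.mu s A ≤ C * Real.log (1 + t) := by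
  refine and_congr_right fun _ => exists_congr fun C => forall₂_congr fun t ht => ?_
  rw [one_div, inv_mul_le_iff₀ (Real.log_pos (by linarith)), mul_comm]

theorem mem_M1Infty_of_mu_le {A B : H →L[ℂ] H} (hA : A ∈ τ.M1Infty) (hB : B ∈ N) {c : ℝ}
    (hc : 0 ≤ c) (h : ∀ t, τ.mu t B ≤ τ.mu t A * c) : B ∈ τ.M1Infty := by
  obtain ⟨-, C, hC⟩ := mem_M1Infty_iff.1 hA
  refine mem_M1Infty_iff.2 ⟨hB, C * c, fun t ht => ?_⟩
  calc ∫ s in (0 : ℝ)..t, τ.mu s B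
      ≤ ∫ s in (0 : ℝ)..t, τ.mu s A * c :=
        intervalIntegral.integral_mono_on ht.le (τ.intervalIntegrable_mu _ _ _)
          ((τ.intervalIntegrable_mu _ _ _).mul_const c) fun s _ => h s
    _ = (∫ s in (0 : ℝ)..t, τ.mu s A) * c := intervalIntegral.integral_mul_const _ _
    _ ≤ C * Real.log (1 + t) * c := by gcongr; exact hC t ht
    _ = C * c * Real.log (1 + t) := by ring

theorem star_mem_M1Infty {A : H →L[ℂ] H} (hA : A ∈ τ.M1Infty) : star A ∈ τ.M1Infty :=
  mem_M1Infty_of_mu_le hA (star_mem hA.1) zero_le_one fun t => by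
    rw [mul_one]; exact τ.mu_star_le t hA.1

theorem mul_mem_M1Infty {A B : H →L[ℂ] H} (hA : A ∈ τ.M1Infty) (hB : B ∈ N) :
    A * B ∈ τ.M1Infty :=
  mem_M1Infty_of_mu_le hA (mul_mem hA.1 hB) (norm_nonneg B) fun t => τ.mu_mul_le t A hB

theorem smul_mem_M1Infty (c : ℂ) {A : H →L[ℂ] H} (hA : A ∈ τ.M1Infty) : c • A ∈ τ.M1Infty := by
  simpa only [mul_smul_comm, mul_one] using
    mul_mem_M1Infty hA (complex_smul_mem_vonNeumann c (one_mem N))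

theorem add_mem_M1Infty {A B : H →L[ℂ] H} (hA : A ∈ τ.M1Infty) (hB : B ∈ τ.M1Infty) :
    A + B ∈ τ.M1Infty := by
  obtain ⟨hAN, C, hC⟩ := mem_M1Infty_iff.1 hA
  obtain ⟨hBN, D, hD⟩ := mem_M1Infty_iff.1 hB
  refine mem_M1Infty_iff.2 ⟨add_mem hAN hBN, 2 * (C + D), fun t ht => ?_⟩
  linarith [τ.integral_mu_add_le ht.le A B, hC t ht, hD t ht]

theorem realPart_mem_M1Infty {A : H →L[ℂ] H} (hA : A ∈ τ.M1Infty) :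
    (ℜ A : H →L[ℂ] H) ∈ τ.M1Infty := by
  rw [realPart_apply_coe, ← Complex.coe_smul]
  exact smul_mem_M1Infty _ (add_mem_M1Infty hA (star_mem_M1Infty hA))

theorem imaginaryPart_mem_M1Infty {A : H →L[ℂ] H} (hA : A ∈ τ.M1Infty) :
    (ℑ A : H →L[ℂ] H) ∈ τ.M1Infty := by
  have h : ℑ A = ℜ (-Complex.I • A) := by rw [neg_smul, map_neg, realPart_I_smul, neg_neg]
  rw [h]
  exact realPart_mem_M1Infty (smul_mem_M1Infty _ hA)

theorem trace_rightSupport_le_of_mu_lt {A : H →L[ℂ] H} (hA : A ∈ N) {t c : ℝ}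
    (h : τ.mu t A < c) :
    τ.toFun (rightSupport (CFC.abs A - algebraMap ℝ (H →L[ℂ] H) c)⁺) ≤ ENNReal.ofReal t := by
  obtain ⟨p, hp, hpp, ht, hpc⟩ := τ.exists_projection_of_mu_lt h
  have hX : IsSelfAdjoint (CFC.abs A - algebraMap ℝ (H →L[ℂ] H) c) :=
    (CFC.abs_nonneg A).isSelfAdjoint.sub (.algebraMap _ (.all _))
  set e := rightSupport (CFC.abs A - algebraMap ℝ (H →L[ℂ] H) c)⁺ with he
  have heN : e ∈ N := rightSupport_mem_vonNeumann
    (posPart_mem_vonNeumann (sub_mem (abs_mem_vonNeumann hA) (algebraMap_real_mem_vonNeumann c)))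
  obtain ⟨r, -, hrr, her, hpr, hle⟩ :=
    τ.exists_projection_le_inf heN (isStarProjection_rightSupport _) hp hpp
  have hre : r * e = r := by
    have h_star := congr(star $her)
    rwa [star_mul, hrr.isSelfAdjoint.star_eq,
      (isStarProjection_rightSupport _).isSelfAdjoint.star_eq] at h_star
  have hcr : c • r ≤ r * CFC.abs A * r := by
    have h_nonneg : 0 ≤ r * (CFC.abs A - algebraMap ℝ (H →L[ℂ] H) c)⁺ * r :=
      hrr.isSelfAdjoint.conjugate_nonneg (CFC.posPart_nonneg _)
    rw [← rightSupport_posPart_conj hX, ← he, ← mul_assoc, ← mul_assoc, hre, mul_assoc _ e r, her,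
      mul_sub, sub_mul, Algebra.algebraMap_eq_smul_one, mul_smul_comm, mul_one, smul_mul_assoc,
      hrr.isIdempotentElem.eq, sub_nonneg] at h_nonneg
    exact h_nonneg
  rw [eq_zero_of_smul_le_conj_abs hrr hpr hcr hpc, sub_zero] at hle
  exact hle.trans ht

theorem trace_posPart_abs_sub_le_add {A : H →L[ℂ] H} (hA : A ∈ N) {t b c : ℝ}
    (h : τ.mu t A < c) (hcb : c ≤ b) :
    τ.toFun (CFC.abs A - algebraMap ℝ (H →L[ℂ] H) c)⁺ ≤
      τ.toFun (CFC.abs A - algebraMap ℝ (H →L[ℂ] H) b)⁺ + ENNReal.ofReal ((b - c) * t) := by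
  have hP : IsSelfAdjoint (CFC.abs A) := (CFC.abs_nonneg A).isSelfAdjoint
  set Tc := (CFC.abs A - algebraMap ℝ (H →L[ℂ] H) c)⁺
  set Tb := (CFC.abs A - algebraMap ℝ (H →L[ℂ] H) b)⁺
  have hTN (x : ℝ) : (CFC.abs A - algebraMap ℝ (H →L[ℂ] H) x)⁺ ∈ N :=
    posPart_mem_vonNeumann (sub_mem (abs_mem_vonNeumann hA) (algebraMap_real_mem_vonNeumann x))
  have he : IsStarProjection (rightSupport Tc) := isStarProjection_rightSupport _
  have heN : rightSupport Tc ∈ N := rightSupport_mem_vonNeumann (hTN c)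
  have hS0 : 0 ≤ Tc - Tb := sub_nonneg.2 (posPart_sub_algebraMap_antitone hP hcb)
  have hSe : Tc - Tb ≤ (b - c) • rightSupport Tc := by
    rw [← rightSupport_conj_of_le hS0 (sub_le_self Tc (CFC.posPart_nonneg _))]
    refine (he.isSelfAdjoint.conjugate_le_conjugate
      (posPart_sub_algebraMap_sub_le hP hcb)).trans_eq ?_
    rw [Algebra.algebraMap_eq_smul_one, mul_smul_comm, mul_one, smul_mul_assoc,
      he.isIdempotentElem.eq]
  have hbc : 0 ≤ b - c := sub_nonneg.2 hcb
  calc τ.toFun Tc = τ.toFun Tb + τ.toFun (Tc - Tb) := by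
        rw [← τ.map_add' _ (hTN b) _ (sub_mem (hTN c) (hTN b)) (CFC.posPart_nonneg _) hS0,
          add_sub_cancel]
    _ ≤ τ.toFun Tb + τ.toFun ((b - c) • rightSupport Tc) := by
        gcongr
        exact τ.mono (sub_mem (hTN c) (hTN b)) (real_smul_mem_vonNeumann _ heN) hS0 hSe
    _ ≤ τ.toFun Tb + ENNReal.ofReal ((b - c) * t) := by
        rw [τ.map_smul' _ hbc _ heN he.nonneg, ENNReal.ofReal_mul hbc]
        gcongr
        exact trace_rightSupport_le_of_mu_lt hA h

theorem trace_posPart_abs_sub_le_sum {A : H →L[ℂ] H} (hA : A ∈ N) {δ : ℝ} (hδ : 0 < δ) (K : ℕ) :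
    τ.toFun (CFC.abs A - algebraMap ℝ (H →L[ℂ] H) (τ.mu (2 ^ K) A + δ))⁺ ≤
      ENNReal.ofReal (‖A‖ + 2 * ∑ k ∈ Finset.range K, 2 ^ k * τ.mu (2 ^ k) A) := by
  induction K with
  | zero =>
    have h_norm : CFC.abs A ≤ algebraMap ℝ (H →L[ℂ] H) (τ.mu (2 ^ 0) A + δ + ‖A‖) := by
      refine (CFC.abs_nonneg A).isSelfAdjoint.le_algebraMap_norm_self.trans ?_
      rw [CFC.norm_abs]
      exact algebraMap_mono _ (by linarith [τ.mu_nonneg (2 ^ 0) A])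
    have h_step := trace_posPart_abs_sub_le_add hA (lt_add_of_pos_right (τ.mu (2 ^ 0) A) hδ)
      (le_add_of_nonneg_right (norm_nonneg A))
    rw [(CFC.posPart_eq_zero_iff _ ((CFC.abs_nonneg A).isSelfAdjoint.sub
      (.algebraMap _ (.all _)))).2 (sub_nonpos.2 h_norm), τ.map_zero, zero_add] at h_step
    simpa using h_step
  | succ K ih =>
    have h_anti : τ.mu (2 ^ (K + 1)) A ≤ τ.mu (2 ^ K) A :=
      τ.mu_antitone A (pow_le_pow_right₀ one_le_two K.le_succ)
    have h_nonneg (k : ℕ) : 0 ≤ τ.mu (2 ^ k) A := τ.mu_nonneg _ _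
    have h_gap : 0 ≤ τ.mu (2 ^ K) A - τ.mu (2 ^ (K + 1)) A := sub_nonneg.2 h_anti
    refine (trace_posPart_abs_sub_le_add hA (lt_add_of_pos_right _ hδ)
      (add_le_add_left h_anti δ)).trans ((add_le_add_left ih _).trans ?_)
    rw [add_sub_add_right_eq_sub, ← ENNReal.ofReal_add
      (add_nonneg (norm_nonneg A) (mul_nonneg zero_le_two (Finset.sum_nonneg fun k _ =>
        mul_nonneg (by positivity) (h_nonneg k)))) (mul_nonneg h_gap (by positivity)),
      Finset.sum_range_succ]
    refine ENNReal.ofReal_le_ofReal ?_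
    have h_step : (τ.mu (2 ^ K) A - τ.mu (2 ^ (K + 1)) A) * 2 ^ (K + 1) ≤
        τ.mu (2 ^ K) A * 2 ^ (K + 1) := by
      gcongr
      linarith [h_nonneg (K + 1)]
    have h_pow : τ.mu (2 ^ K) A * 2 ^ (K + 1) = 2 * (2 ^ K * τ.mu (2 ^ K) A) := by
      rw [pow_succ]
      ring
    linarith

variable (τ) in
theorem sum_two_pow_mul_mu_le (A : H →L[ℂ] H) (K : ℕ) :
    ∑ k ∈ Finset.range (K + 1), 2 ^ k * τ.mu (2 ^ k) A ≤
      2 * ∫ s in (0 : ℝ)..2 ^ K, τ.mu s A := by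
  induction K with
  | zero =>
    have h_unit := τ.sub_mul_mu_le_integral zero_le_one A
    simp only [zero_add, Finset.range_one, Finset.sum_singleton, pow_zero, one_mul, sub_zero]
      at h_unit ⊢
    linarith [τ.mu_nonneg 1 A]
  | succ K ih =>
    have h_dyadic := τ.sub_mul_mu_le_integral
      (pow_le_pow_right₀ (one_le_two : (1 : ℝ) ≤ 2) (Nat.le_add_right K 1)) A
    rw [Finset.sum_range_succ, ← intervalIntegral.integral_add_adjacent_intervals
      (τ.intervalIntegrable_mu A 0 (2 ^ K)) (τ.intervalIntegrable_mu A _ (2 ^ (K + 1)))]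
    have h_pow : (2 : ℝ) ^ (K + 1) * τ.mu (2 ^ (K + 1)) A =
        2 * ((2 ^ (K + 1) - 2 ^ K) * τ.mu (2 ^ (K + 1)) A) := by
      generalize τ.mu (2 ^ (K + 1)) A = m
      ring
    linarith

theorem exists_integral_mu_two_pow_le {A : H →L[ℂ] H} (hA : A ∈ τ.M1Infty) :
    ∃ C : ℝ, 0 ≤ C ∧ ∀ K : ℕ, ∫ s in (0 : ℝ)..2 ^ K, τ.mu s A ≤ C * (K + 1) := by
  obtain ⟨-, C, hC⟩ := mem_M1Infty_iff.1 hA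
  refine ⟨max C 0, le_max_right _ _, fun K => (hC _ (by positivity)).trans ?_⟩
  have h_one_le : (1 : ℝ) ≤ 2 ^ K := one_le_pow₀ one_le_two
  have h_log_nonneg : 0 ≤ Real.log (1 + 2 ^ K) := Real.log_nonneg (by linarith)
  have h_log : Real.log (1 + 2 ^ K) ≤ K + 1 := by
    calc Real.log (1 + 2 ^ K) ≤ Real.log (2 ^ (K + 1)) :=
          Real.log_le_log (by positivity) (by rw [pow_succ]; linarith)
      _ = (K + 1 : ℕ) * Real.log 2 := Real.log_pow _ _
      _ ≤ (K + 1 : ℕ) * 1 := by gcongr; linarith [Real.log_two_lt_d9]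
      _ = K + 1 := by push_cast; ring
  exact mul_le_mul (le_max_left _ _) h_log h_log_nonneg (le_max_right _ _)

theorem exists_mu_lt_one_half_pow {A : H →L[ℂ] H} (hA : A ∈ τ.M1Infty) :
    ∃ n : ℕ, ∀ j : ℕ, τ.mu (2 ^ (2 * (j + n))) A < (1 / 2) ^ j := by
  obtain ⟨C, hC0, hC⟩ := exists_integral_mu_two_pow_le hA
  obtain ⟨n, hn⟩ := pow_unbounded_of_one_lt (2 * C) (one_lt_two : (1 : ℝ) < 2)
  refine ⟨n, fun j => ?_⟩
  set i := j + n with hi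
  have hi_lt : (i : ℝ) + 1 ≤ 2 ^ i := mod_cast i.lt_two_pow_self
  have h_pow : (2 : ℝ) ^ (2 * i) = 2 ^ i * 2 ^ i := by rw [two_mul, pow_add]
  have h_pos : (0 : ℝ) < 2 ^ i := by positivity
  have h_scaled : 2 ^ i * (2 ^ i * τ.mu (2 ^ (2 * i)) A) ≤ 2 ^ i * (2 * C) := by
    calc 2 ^ i * (2 ^ i * τ.mu (2 ^ (2 * i)) A)
        = (2 ^ (2 * i) - 0) * τ.mu (2 ^ (2 * i)) A := by rw [sub_zero, ← mul_assoc, ← h_pow]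
      _ ≤ ∫ s in (0 : ℝ)..2 ^ (2 * i), τ.mu s A := τ.sub_mul_mu_le_integral (by positivity) A
      _ ≤ C * ((2 * i : ℕ) + 1) := hC (2 * i)
      _ ≤ C * (2 * 2 ^ i) := by gcongr; push_cast; linarith
      _ = 2 ^ i * (2 * C) := by ring
  have h_lt : 2 ^ i * τ.mu (2 ^ (2 * i)) A < 2 ^ n :=
    (le_of_mul_le_mul_left h_scaled h_pos).trans_lt hn
  rw [one_div_pow, lt_div_iff₀ (by positivity)]
  refine lt_of_mul_lt_mul_left (a := (2 : ℝ) ^ n) ?_ (by positivity)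
  calc 2 ^ n * (τ.mu (2 ^ (2 * i)) A * 2 ^ j) = 2 ^ i * τ.mu (2 ^ (2 * i)) A := by
        rw [hi, pow_add]
        generalize τ.mu _ A = m
        ring
    _ < 2 ^ n * 1 := by rwa [mul_one]

theorem abs_mem_logCone {A : H →L[ℂ] H} (hA : A ∈ τ.M1Infty) : CFC.abs A ∈ τ.logCone := by
  obtain ⟨C, hC0, hC⟩ := exists_integral_mu_two_pow_le hA
  obtain ⟨n, hn⟩ := exists_mu_lt_one_half_pow hA
  refine ⟨abs_mem_vonNeumann hA.1, CFC.abs_nonneg A,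
    Real.toNNReal (‖A‖ + 8 * C * (n + 1)), fun j => ?_⟩
  have h_trace := trace_posPart_abs_sub_le_sum (τ := τ) hA.1 (sub_pos.2 (hn j)) (2 * (j + n))
  rw [add_sub_cancel] at h_trace
  have h_sum : ∑ k ∈ Finset.range (2 * (j + n)), 2 ^ k * τ.mu (2 ^ k) A ≤
      2 * (C * ((2 * (j + n) : ℕ) + 1)) := by
    refine (Finset.sum_le_sum_of_subset_of_nonneg (Finset.range_subset_range.2 (Nat.le_succ _))
      fun k _ _ => mul_nonneg (by positivity) (τ.mu_nonneg _ _)).trans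
      ((τ.sum_two_pow_mul_mu_le A _).trans ?_)
    gcongr
    exact hC _
  have h_bound : ‖A‖ + 2 * ∑ k ∈ Finset.range (2 * (j + n)), 2 ^ k * τ.mu (2 ^ k) A ≤
      (‖A‖ + 8 * C * (n + 1)) * (j + 1) := by
    push_cast at h_sum
    have : 0 ≤ ‖A‖ * j := by positivity
    have : 0 ≤ C * n * j := by positivity
    linarith
  refine h_trace.trans ((ENNReal.ofReal_le_ofReal h_bound).trans_eq ?_)
  rw [ENNReal.ofReal_mul (by positivity), ENNReal.ofReal_add (by positivity) zero_le_one,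
    ENNReal.ofReal_natCast, ENNReal.ofReal_one]
  rfl

theorem jordanForall_mem_logCone {A : H →L[ℂ] H} (hA : A ∈ τ.M1Infty) :
    JordanForall (· ∈ τ.logCone) A := by
  have h_parts {X : H →L[ℂ] H} (hX : X ∈ τ.M1Infty) (hXs : IsSelfAdjoint X) :
      X⁺ ∈ τ.logCone ∧ X⁻ ∈ τ.logCone := by
    have h_abs := abs_mem_logCone hX
    have h_eq := CFC.posPart_add_negPart X hXs
    exact ⟨mem_logCone_of_le h_abs (posPart_mem_vonNeumann hX.1) (CFC.posPart_nonneg X)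
        (h_eq ▸ le_add_of_nonneg_right (CFC.negPart_nonneg X)),
      mem_logCone_of_le h_abs (negPart_mem_vonNeumann hX.1) (CFC.negPart_nonneg X)
        (h_eq ▸ le_add_of_nonneg_left (CFC.posPart_nonneg X))⟩
  obtain ⟨h₁, h₂⟩ := h_parts (realPart_mem_M1Infty hA) (ℜ A).2
  obtain ⟨h₃, h₄⟩ := h_parts (imaginaryPart_mem_M1Infty hA) (ℑ A).2
  exact ⟨h₁, h₂, h₃, h₄⟩

end FNSTrace

end SingularValues

section GeneralisedLimits

open Filter Topology

variable {x y : Set.Ioi (0 : ℝ) → ℝ}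

theorem tailPart_apply_of_one_le {t : Set.Ioi (0 : ℝ)} (ht : (1 : ℝ) ≤ t) :
    tailPart x t = x t :=
  Set.indicator_of_mem (s := {t : Set.Ioi (0 : ℝ) | (1 : ℝ) ≤ t}) ht x

theorem tailPart_apply_of_lt_one {t : Set.Ioi (0 : ℝ)} (ht : (t : ℝ) < 1) : tailPart x t = 0 :=
  Set.indicator_of_notMem (s := {t : Set.Ioi (0 : ℝ) | (1 : ℝ) ≤ t}) (not_le.2 ht) x

theorem tailPart_add : tailPart (fun t => x t + y t) = tailPart x + tailPart y :=
  Set.indicator_add _ x y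

theorem tailPart_const_mul (c : ℝ) : tailPart (fun t => c * x t) = c • tailPart x :=
  Set.indicator_const_smul _ c x

theorem tailPart_add_mem (hx : tailPart x ∈ LInfty) (hy : tailPart y ∈ LInfty) :
    tailPart (fun t => x t + y t) ∈ LInfty := by
  rw [tailPart_add]
  exact add_mem hx hy

theorem tailPart_const_mul_mem (c : ℝ) (hx : tailPart x ∈ LInfty) :
    tailPart (fun t => c * x t) ∈ LInfty := by
  rw [tailPart_const_mul]
  exact LInfty.smul_mem c hx

theorem tailPart_sub_mem (hx : tailPart x ∈ LInfty) (hy : tailPart y ∈ LInfty) :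
    tailPart (fun t => x t - y t) ∈ LInfty := by
  simpa only [neg_one_mul, ← sub_eq_add_neg] using
    tailPart_add_mem hx (tailPart_const_mul_mem (-1) hy)

theorem tailPart_max_zero_mem (hx : tailPart x ∈ LInfty) :
    tailPart (fun t => max (x t) 0) ∈ LInfty := by
  have h_max : tailPart (fun t => max (x t) 0) = fun t => max (tailPart x t) 0 := by
    ext t
    rcases le_or_gt 1 (t : ℝ) with ht | ht
    · simp only [tailPart_apply_of_one_le ht]
    · simp only [tailPart_apply_of_lt_one ht, max_self]
  obtain ⟨h_meas, C, hC⟩ := hx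
  rw [h_max]
  refine ⟨h_meas.max aemeasurable_const, C, fun t => ?_⟩
  rw [abs_of_nonneg (le_max_right _ _)]
  exact max_le ((le_abs_self _).trans (hC t)) ((abs_nonneg _).trans (hC t))

theorem eventually_one_lt_Ioi : ∀ᶠ t : Set.Ioi (0 : ℝ) in atTop, (1 : ℝ) < t :=
  eventually_atTop.2 ⟨⟨2, Set.mem_Ioi.2 two_pos⟩, fun _ ht => one_lt_two.trans_le ht⟩

theorem tendsto_rpow_one_div_sub_one_mul (hx : tailPart x ∈ LInfty) {c : ℝ} (hc : c ≠ 0) :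
    Tendsto (fun t : Set.Ioi (0 : ℝ) => (c ^ (1 / (t : ℝ)) - 1) * x t) atTop (𝓝 0) := by
  have h_inv : Tendsto (fun t : Set.Ioi (0 : ℝ) => 1 / (t : ℝ)) atTop (𝓝 0) := by
    simp only [one_div]
    exact tendsto_inv_atTop_zero.comp (tendsto_comp_val_Ioi_atTop.2 tendsto_id)
  have h_rpow : Tendsto (fun t : Set.Ioi (0 : ℝ) => c ^ (1 / (t : ℝ)) - 1) atTop (𝓝 0) := by
    simpa only [Real.rpow_zero, sub_self, Function.comp_def] using
      ((Real.continuousAt_const_rpow hc).tendsto.comp h_inv).sub_const 1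
  obtain ⟨-, C, hC⟩ := hx
  refine h_rpow.zero_mul_isBoundedUnder_le ⟨C, eventually_map.2 ?_⟩
  filter_upwards [eventually_one_lt_Ioi] with t ht
  simpa only [Function.comp_apply, Real.norm_eq_abs, tailPart_apply_of_one_le ht.le] using hC t

namespace GeneralisedLimit

variable (γ : GeneralisedLimit)

theorem eval_of_mem (hx : tailPart x ∈ LInfty) : γ.eval x = γ.toLinearMap ⟨tailPart x, hx⟩ :=
  dif_pos hx

theorem eval_add (hx : tailPart x ∈ LInfty) (hy : tailPart y ∈ LInfty) :
    γ.eval (fun t => x t + y t) = γ.eval x + γ.eval y := by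
  rw [γ.eval_of_mem hx, γ.eval_of_mem hy, γ.eval_of_mem (tailPart_add_mem hx hy), ← map_add]
  exact congrArg _ (Subtype.ext tailPart_add)

theorem eval_const_mul (c : ℝ) (hx : tailPart x ∈ LInfty) :
    γ.eval (fun t => c * x t) = c * γ.eval x := by
  rw [γ.eval_of_mem hx, γ.eval_of_mem (tailPart_const_mul_mem c hx), ← smul_eq_mul, ← map_smul]
  exact congrArg _ (Subtype.ext (tailPart_const_mul c))

theorem eval_sub (hx : tailPart x ∈ LInfty) (hy : tailPart y ∈ LInfty) :
    γ.eval (fun t => x t - y t) = γ.eval x - γ.eval y := by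
  have h := γ.eval_add hx (tailPart_const_mul_mem (-1) hy)
  rw [γ.eval_const_mul (-1) hy] at h
  simpa only [neg_one_mul, ← sub_eq_add_neg] using h

theorem eval_nonneg (h : ∀ t : Set.Ioi (0 : ℝ), (1 : ℝ) ≤ t → 0 ≤ x t) : 0 ≤ γ.eval x := by
  by_cases hx : tailPart x ∈ LInfty
  · rw [γ.eval_of_mem hx]
    exact γ.nonneg' _ fun t => Set.indicator_nonneg h t
  · exact (show γ.eval x = 0 from dif_neg hx).ge

theorem eval_mono (hx : tailPart x ∈ LInfty) (hy : tailPart y ∈ LInfty)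
    (h : ∀ t : Set.Ioi (0 : ℝ), (1 : ℝ) ≤ t → x t ≤ y t) : γ.eval x ≤ γ.eval y := by
  rw [← sub_nonneg, ← γ.eval_sub hy hx]
  exact γ.eval_nonneg fun t ht => sub_nonneg.2 (h t ht)

theorem eval_eq_zero_of_tendsto (h : Tendsto x atTop (𝓝 0)) : γ.eval x = 0 := by
  by_cases hx : tailPart x ∈ LInfty
  · rw [γ.eval_of_mem hx]
    refine γ.vanish' _ fun ε hε => ?_
    obtain ⟨T, hT⟩ := eventually_atTop.1 ((Metric.tendsto_nhds.1 h ε hε).and eventually_one_lt_Ioi)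
    refine ⟨T, fun t ht => ?_⟩
    obtain ⟨h_dist, h_one⟩ := hT t ht
    simpa only [tailPart_apply_of_one_le h_one.le, Real.dist_0_eq_abs] using h_dist.le
  · exact dif_neg hx

theorem eval_le_of_eventually_le_add (hx : tailPart x ∈ LInfty) (hy : tailPart y ∈ LInfty)
    (h : ∀ ε : ℝ, 0 < ε → ∀ᶠ t in atTop, x t ≤ y t + ε) : γ.eval x ≤ γ.eval y := by
  have h_excess : Tendsto (fun t => max (x t - y t) 0) atTop (𝓝 0) := by
    refine Metric.tendsto_nhds.2 fun ε hε => ?_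
    filter_upwards [h (ε / 2) (half_pos hε)] with t ht
    rw [Real.dist_0_eq_abs, abs_of_nonneg (le_max_right _ _)]
    exact max_lt (by linarith) hε
  have h_excess_mem := tailPart_max_zero_mem (tailPart_sub_mem hx hy)
  calc γ.eval x ≤ γ.eval fun t => y t + max (x t - y t) 0 :=
        γ.eval_mono hx (tailPart_add_mem hy h_excess_mem) fun t _ =>
          sub_le_iff_le_add'.1 (le_max_left _ _)
    _ = γ.eval y := by
        rw [γ.eval_add hy h_excess_mem, γ.eval_eq_zero_of_tendsto h_excess, add_zero]

theorem eval_le_of_le_rpow_mul (hx : tailPart x ∈ LInfty) (hy : tailPart y ∈ LInfty) {c : ℝ}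
    (hc : c ≠ 0)
    (h : ∀ t : Set.Ioi (0 : ℝ), (1 : ℝ) < t → x t ≤ c ^ (1 / (t : ℝ)) * y t) :
    γ.eval x ≤ γ.eval y := by
  refine γ.eval_le_of_eventually_le_add hx hy fun ε hε => ?_
  filter_upwards [(tendsto_rpow_one_div_sub_one_mul hy hc).eventually_le_const hε,
    eventually_one_lt_Ioi] with t h_small ht
  linarith [h t ht]

end GeneralisedLimit

end GeneralisedLimits

section Zeta

variable {H : Type*} [NormedAddCommGroup H] [InnerProductSpace ℂ H] [CompleteSpace H]

namespace FNSTrace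

variable {N : VonNeumannAlgebra H} {τ : FNSTrace N}

section TraceInequalities

variable {P Q R b : H →L[ℂ] H} {s : ℝ}

variable (τ) in
/-- The trace, as a tracial functional on the positive operators of finite trace; its extension is
the extended trace on `L₁(N, τ)`. -/
noncomputable def traceFunctional : TracialFunctional N where
  cone := {P | P ∈ N ∧ 0 ≤ P ∧ τ.toFun P < ∞}
  val P := (τ.toFun P).toReal
  mem_alg _ h := h.1
  nonneg _ h := h.2.1
  zero_mem := ⟨zero_mem N, le_rfl, by simp [τ.map_zero]⟩
  add_mem P hP Q hQ := ⟨add_mem hP.1 hQ.1, add_nonneg hP.2.1 hQ.2.1, by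
    rw [τ.map_add' P hP.1 Q hQ.1 hP.2.1 hQ.2.1]
    exact ENNReal.add_lt_top.2 ⟨hP.2.2, hQ.2.2⟩⟩
  posPart_mem P hP X hX hXs hXP := ⟨posPart_mem_vonNeumann hX, CFC.posPart_nonneg X,
    (τ.posPart_le hX hP.1 hXs hP.2.1 hXP).trans_lt hP.2.2⟩
  swap_mem X hX h := ⟨mul_mem hX (star_mem hX), mul_star_self_nonneg X, by
    rw [← τ.tracial' X hX]
    exact h.2.2⟩
  val_add P hP Q hQ := by
    rw [τ.map_add' P hP.1 Q hQ.1 hP.2.1 hQ.2.1, ENNReal.toReal_add hP.2.2.ne hQ.2.2.ne]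
  val_swap X hX _ := by rw [τ.tracial' X hX]

theorem rpow_mem_traceFunctional_cone (hP : P ∈ τ.logCone) (hs : 0 < s) :
    P ^ (1 + s) ∈ τ.traceFunctional.cone :=
  ⟨rpow_mem_vonNeumann hP.1 _, CFC.rpow_nonneg, trace_rpow_lt_top hP hs⟩

theorem trace_rpow_le_of_le (hP : P ∈ N) (hR : R ∈ N) (hP0 : 0 ≤ P) (hPR : P ≤ R) (hs : 0 < s)
    (hs1 : s ≤ 1) :
    τ.toFun (P ^ (1 + s)) ≤ τ.toFun (CFC.sqrt (R ^ s) * P * CFC.sqrt (R ^ s)) := by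
  have hsP := sqrt_mem_vonNeumann hP
  rw [τ.sqrt_conj_comm (rpow_mem_vonNeumann hR s) hP CFC.rpow_nonneg hP0,
    ← sqrt_mul_rpow_mul_sqrt P hs]
  exact τ.mono (mul_mem (mul_mem hsP (rpow_mem_vonNeumann hP s)) hsP)
    (mul_mem (mul_mem hsP (rpow_mem_vonNeumann hR s)) hsP) (sqrt_conj_nonneg _ CFC.rpow_nonneg)
    (sqrt_conj_mono _ (CFC.rpow_le_rpow ⟨hs.le, hs1⟩ hPR))

theorem trace_rpow_add_le (hP : P ∈ N) (hQ : Q ∈ N) (hP0 : 0 ≤ P) (hQ0 : 0 ≤ Q) (hs : 0 < s)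
    (hs1 : s ≤ 1) :
    τ.toFun (P ^ (1 + s)) + τ.toFun (Q ^ (1 + s)) ≤ τ.toFun ((P + Q) ^ (1 + s)) := by
  have hR := add_mem hP hQ
  have hsN := sqrt_mem_vonNeumann (rpow_mem_vonNeumann hR s)
  refine (add_le_add
    (trace_rpow_le_of_le hP hR hP0 (le_add_of_nonneg_right hQ0) hs hs1)
    (trace_rpow_le_of_le hQ hR hQ0 (le_add_of_nonneg_left hP0) hs hs1)).trans_eq ?_
  rw [← τ.map_add' _ (mul_mem (mul_mem hsN hP) hsN) _ (mul_mem (mul_mem hsN hQ) hsN)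
    (sqrt_conj_nonneg _ hP0) (sqrt_conj_nonneg _ hQ0), ← add_mul, ← mul_add,
    sqrt_rpow_conj (add_nonneg hP0 hQ0) hs]

theorem trace_add_rpow_le (hP : P ∈ N) (hQ : Q ∈ N) (hP0 : 0 ≤ P) (hQ0 : 0 ≤ Q) (hs : 0 < s)
    (hs1 : s < 1) :
    τ.toFun ((P + Q) ^ (1 + s)) ≤
      ENNReal.ofReal (2 ^ s) * (τ.toFun (P ^ (1 + s)) + τ.toFun (Q ^ (1 + s))) := by
  have hpN := rpow_mem_vonNeumann hP (1 + s)
  have hqN := rpow_mem_vonNeumann hQ (1 + s)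
  rw [← τ.map_add' _ hpN _ hqN CFC.rpow_nonneg CFC.rpow_nonneg,
    ← τ.map_smul' _ (by positivity) _ (add_mem hpN hqN)
      (add_nonneg CFC.rpow_nonneg CFC.rpow_nonneg)]
  exact τ.mono (rpow_mem_vonNeumann (add_mem hP hQ) _)
    (real_smul_mem_vonNeumann _ (add_mem hpN hqN)) CFC.rpow_nonneg (add_rpow_le hP0 hQ0 hs hs1)

theorem trace_sqrt_conj_rpow_le (hP : P ∈ N) (hP0 : 0 ≤ P) (hb : b ∈ N) (hb0 : 0 ≤ b) {c : ℝ}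
    (hc : 0 ≤ c) (hbc : b ≤ algebraMap ℝ (H →L[ℂ] H) c) (hs : 0 < s) (hs1 : s ≤ 1) :
    τ.toFun ((CFC.sqrt P * b * CFC.sqrt P) ^ (1 + s)) ≤ ENNReal.ofReal (c ^ s) *
      τ.toFun (CFC.sqrt (P ^ (1 + s)) * b * CFC.sqrt (P ^ (1 + s))) := by
  rw [← sqrt_rpow_sqrt_conj P b hs]
  have hX_le : CFC.sqrt P * b * CFC.sqrt P ≤ c • P := by
    refine (sqrt_conj_mono P hbc).trans_eq ?_
    rw [Algebra.algebraMap_eq_smul_one, mul_smul_comm, mul_one, smul_mul_assoc,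
      CFC.sqrt_mul_sqrt_self P hP0]
  have hXN : CFC.sqrt P * b * CFC.sqrt P ∈ N :=
    mul_mem (mul_mem (sqrt_mem_vonNeumann hP) hb) (sqrt_mem_vonNeumann hP)
  have hX0 : 0 ≤ CFC.sqrt P * b * CFC.sqrt P := sqrt_conj_nonneg P hb0
  generalize CFC.sqrt P * b * CFC.sqrt P = X at hX_le hXN hX0 ⊢
  have hsX := sqrt_mem_vonNeumann hXN
  have hPs := rpow_mem_vonNeumann hP s
  have hcPN := real_smul_mem_vonNeumann c hP
  refine (trace_rpow_le_of_le hXN hcPN hX0 hX_le hs hs1).trans_eq ?_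
  rw [τ.sqrt_conj_comm (rpow_mem_vonNeumann hcPN s) hXN CFC.rpow_nonneg hX0,
    τ.sqrt_conj_comm hPs hXN CFC.rpow_nonneg hX0, smul_rpow_of_nonneg hP0 hc hs.le,
    mul_smul_comm, smul_mul_assoc, τ.map_smul' _ (by positivity) _
      (mul_mem (mul_mem hsX hPs) hsX) (sqrt_conj_nonneg _ CFC.rpow_nonneg)]

end TraceInequalities

section ZetaFunctions

variable {P Q b c : H →L[ℂ] H}

variable (τ) in
/-- The function `t ↦ t⁻¹ τ(A^{1/2} b A^{1/2})` with `A = P ^ (1 + 1/t)`, for positive `P` and `b`.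
It equals `t ↦ t⁻¹ τ(P ^ (1 + 1/t) b)`, but involves the trace of positive operators only. -/
noncomputable def zetaFunConj (b P : H →L[ℂ] H) (t : Set.Ioi (0 : ℝ)) : ℝ :=
  1 / (t : ℝ) * (τ.toFun (CFC.sqrt (P ^ (1 + 1 / (t : ℝ))) * b *
    CFC.sqrt (P ^ (1 + 1 / (t : ℝ))))).toReal

theorem zetaFunConj_one (P : H →L[ℂ] H) : τ.zetaFunConj 1 P = τ.zetaFun P := by
  ext t
  rw [zetaFunConj, zetaFun, mul_one, CFC.sqrt_mul_sqrt_self _ CFC.rpow_nonneg]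

theorem zetaFunConj_nonneg (b P : H →L[ℂ] H) (t : Set.Ioi (0 : ℝ)) : 0 ≤ τ.zetaFunConj b P t :=
  mul_nonneg (one_div_nonneg.2 (le_of_lt t.2)) ENNReal.toReal_nonneg

theorem zetaFunConj_add (hP : P ∈ τ.logCone) (hb : b ∈ N) (hb0 : 0 ≤ b) (hc : c ∈ N)
    (hc0 : 0 ≤ c) (t : Set.Ioi (0 : ℝ)) :
    τ.zetaFunConj (b + c) P t = τ.zetaFunConj b P t + τ.zetaFunConj c P t := by
  have hPt : P ^ (1 + 1 / (t : ℝ)) ∈ τ.traceFunctional.cone :=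
    rpow_mem_traceFunctional_cone hP (one_div_pos.2 t.2)
  have h_add := τ.traceFunctional.val_add _ (TracialFunctional.sqrt_conj_mem hPt hb hb0) _
    (TracialFunctional.sqrt_conj_mem hPt hc hc0)
  rw [← add_mul, ← mul_add] at h_add
  exact (congrArg (1 / (t : ℝ) * ·) h_add).trans (mul_add _ _ _)

theorem zetaFunConj_natCast (hP : P ∈ τ.logCone) (n : ℕ) (t : Set.Ioi (0 : ℝ)) :
    τ.zetaFunConj (n : H →L[ℂ] H) P t = n * τ.zetaFun P t := by
  rw [← zetaFunConj_one]
  induction n with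
  | zero => simp [zetaFunConj, τ.map_zero]
  | succ n ih =>
    rw [Nat.cast_succ, zetaFunConj_add hP (natCast_mem N n)
      (by rw [← nsmul_one]; exact nsmul_nonneg zero_le_one n) (one_mem N) zero_le_one, ih]
    push_cast
    ring

theorem zetaFunConj_add_natCast_sub (hP : P ∈ τ.logCone) (hb : b ∈ N) (hb0 : 0 ≤ b) {n : ℕ}
    (hbn : b ≤ n) (t : Set.Ioi (0 : ℝ)) :
    τ.zetaFunConj b P t + τ.zetaFunConj ((n : H →L[ℂ] H) - b) P t = n * τ.zetaFun P t := by
  rw [← zetaFunConj_add hP hb hb0 (sub_mem (natCast_mem N n) hb) (sub_nonneg.2 hbn),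
    add_sub_cancel, zetaFunConj_natCast hP]

theorem exists_zetaFun_le (hP : P ∈ τ.logCone) :
    ∃ K : ℝ, 0 ≤ K ∧ ∀ t : Set.Ioi (0 : ℝ), (1 : ℝ) ≤ t → τ.zetaFun P t ≤ K := by
  obtain ⟨K, hK0, hK⟩ := exists_trace_rpow_le hP
  refine ⟨K, hK0, fun t ht => ?_⟩
  have ht0 : 0 < (t : ℝ) := t.2
  have h := ENNReal.toReal_le_of_le_ofReal (by positivity)
    (hK (1 / (t : ℝ)) (by positivity) ((div_le_one ht0).2 ht))
  calc τ.zetaFun P t ≤ 1 / (t : ℝ) * (K / (1 / (t : ℝ))) :=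
        mul_le_mul_of_nonneg_left h (by positivity)
    _ = K := by field_simp

theorem monotone_ofReal_rpow_mul_trace_sqrt_conj_rpow (hP : P ∈ N) (hP0 : 0 ≤ P) (hb : b ∈ N)
    {r : ℝ} (hr : 0 < r) (hPr : P ≤ algebraMap ℝ (H →L[ℂ] H) r) :
    Monotone fun t : Set.Ioi (0 : ℝ) => ENNReal.ofReal (r ^ (-(1 + 1 / (t : ℝ)))) *
      τ.toFun (CFC.sqrt b * P ^ (1 + 1 / (t : ℝ)) * CFC.sqrt b) := by
  intro t u htu
  have ht : 0 < (t : ℝ) := t.2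
  have hu : 0 < (u : ℝ) := u.2
  set p : ℝ := 1 + 1 / (u : ℝ)
  set q : ℝ := 1 + 1 / (t : ℝ)
  have hpq : p ≤ q := add_le_add_right (one_div_le_one_div_of_le ht htu) 1
  have hsb := sqrt_mem_vonNeumann hb
  have hN (v : ℝ) : CFC.sqrt b * P ^ v * CFC.sqrt b ∈ N :=
    mul_mem (mul_mem hsb (rpow_mem_vonNeumann hP v)) hsb
  have h_nonneg (v : ℝ) : 0 ≤ CFC.sqrt b * P ^ v * CFC.sqrt b :=
    sqrt_conj_nonneg b CFC.rpow_nonneg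
  have h_le : CFC.sqrt b * P ^ q * CFC.sqrt b ≤
      r ^ (q - p) • (CFC.sqrt b * P ^ p * CFC.sqrt b) := by
    rw [← smul_mul_assoc, ← mul_smul_comm]
    exact sqrt_conj_mono b (rpow_le_smul_rpow hP0 hPr (by positivity) hpq)
  calc ENNReal.ofReal (r ^ (-q)) * τ.toFun (CFC.sqrt b * P ^ q * CFC.sqrt b)
      ≤ ENNReal.ofReal (r ^ (-q)) *
          τ.toFun (r ^ (q - p) • (CFC.sqrt b * P ^ p * CFC.sqrt b)) := by
        gcongr
        exact τ.mono (hN q) (real_smul_mem_vonNeumann _ (hN p)) (h_nonneg q) h_le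
    _ = ENNReal.ofReal (r ^ (-p)) * τ.toFun (CFC.sqrt b * P ^ p * CFC.sqrt b) := by
        rw [τ.map_smul' _ (by positivity) _ (hN p) (h_nonneg p), ← mul_assoc,
          ← ENNReal.ofReal_mul (by positivity), ← Real.rpow_add hr]
        ring_nf

theorem measurable_zetaFunConj (hP : P ∈ N) (hP0 : 0 ≤ P) (hb : b ∈ N) (hb0 : 0 ≤ b) :
    Measurable (τ.zetaFunConj b P) := by
  set r : ℝ := ‖P‖ + 1
  have hr : 0 < r := by positivity
  have hPr : P ≤ algebraMap ℝ (H →L[ℂ] H) r :=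
    hP0.isSelfAdjoint.le_algebraMap_norm_self.trans
      (algebraMap_mono _ (le_add_of_nonneg_right zero_le_one))
  have h_meas := (monotone_ofReal_rpow_mul_trace_sqrt_conj_rpow (τ := τ) hP hP0 hb hr
    hPr).measurable.ennreal_toReal
  have h_eq : τ.zetaFunConj b P = fun t : Set.Ioi (0 : ℝ) => 1 / (t : ℝ) *
      (r ^ (1 + 1 / (t : ℝ)) * (ENNReal.ofReal (r ^ (-(1 + 1 / (t : ℝ)))) *
        τ.toFun (CFC.sqrt b * P ^ (1 + 1 / (t : ℝ)) * CFC.sqrt b)).toReal) := by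
    ext t
    rw [zetaFunConj, τ.sqrt_conj_comm (rpow_mem_vonNeumann hP _) hb CFC.rpow_nonneg hb0,
      ENNReal.toReal_mul, ENNReal.toReal_ofReal (by positivity), ← mul_assoc (r ^ _),
      ← Real.rpow_add hr, add_neg_cancel, Real.rpow_zero, one_mul]
  rw [h_eq]
  fun_prop

theorem tailPart_zetaFunConj_mem (hP : P ∈ τ.logCone) (hb : b ∈ N) (hb0 : 0 ≤ b) :
    tailPart (τ.zetaFunConj b P) ∈ LInfty := by
  have h_meas : MeasurableSet {t : Set.Ioi (0 : ℝ) | (1 : ℝ) ≤ t} :=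
    measurableSet_le measurable_const measurable_subtype_coe
  refine ⟨((measurable_zetaFunConj hP.1 hP.2.1 hb hb0).indicator h_meas).aemeasurable, ?_⟩
  obtain ⟨K, hK0, hK⟩ := exists_zetaFun_le hP
  obtain ⟨n, hn⟩ := exists_nat_ge ‖b‖
  have hbn : b ≤ n := (CStarAlgebra.norm_le_natCast_iff_of_nonneg b n).1 hn
  refine ⟨n * K, fun t => ?_⟩
  rcases le_or_gt 1 (t : ℝ) with ht | ht
  · rw [tailPart_apply_of_one_le ht, abs_of_nonneg (zetaFunConj_nonneg b P t)]
    calc τ.zetaFunConj b P t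
        ≤ τ.zetaFunConj b P t + τ.zetaFunConj ((n : H →L[ℂ] H) - b) P t :=
          le_add_of_nonneg_right (zetaFunConj_nonneg _ P t)
      _ = n * τ.zetaFun P t := zetaFunConj_add_natCast_sub hP hb hb0 hbn t
      _ ≤ n * K := mul_le_mul_of_nonneg_left (hK t ht) n.cast_nonneg
  · rw [tailPart_apply_of_lt_one ht, abs_zero]
    positivity

theorem tailPart_zetaFun_mem (hP : P ∈ τ.logCone) : tailPart (τ.zetaFun P) ∈ LInfty := by
  rw [← zetaFunConj_one]
  exact tailPart_zetaFunConj_mem hP (one_mem N) zero_le_one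

theorem zetaFun_add_le (hP : P ∈ τ.logCone) (hQ : Q ∈ τ.logCone) {t : Set.Ioi (0 : ℝ)}
    (ht : (1 : ℝ) < t) :
    τ.zetaFun (P + Q) t ≤ 2 ^ (1 / (t : ℝ)) * (τ.zetaFun P t + τ.zetaFun Q t) := by
  have ht0 : 0 < (t : ℝ) := t.2
  have hs : 0 < 1 / (t : ℝ) := one_div_pos.2 ht0
  have hPt := (trace_rpow_lt_top hP hs).ne
  have hQt := (trace_rpow_lt_top hQ hs).ne
  have h := ENNReal.toReal_mono (ENNReal.mul_ne_top ENNReal.ofReal_ne_top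
    (ENNReal.add_ne_top.2 ⟨hPt, hQt⟩))
    (τ.trace_add_rpow_le hP.1 hQ.1 hP.2.1 hQ.2.1 hs ((div_lt_one ht0).2 ht))
  rw [ENNReal.toReal_mul, ENNReal.toReal_ofReal (by positivity), ENNReal.toReal_add hPt hQt] at h
  rw [zetaFun, zetaFun, zetaFun, ← mul_add, mul_left_comm]
  exact mul_le_mul_of_nonneg_left h hs.le

theorem zetaFun_add_zetaFun_le (hP : P ∈ τ.logCone) (hQ : Q ∈ τ.logCone) {t : Set.Ioi (0 : ℝ)}
    (ht : (1 : ℝ) ≤ t) : τ.zetaFun P t + τ.zetaFun Q t ≤ τ.zetaFun (P + Q) t := by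
  have ht0 : 0 < (t : ℝ) := t.2
  have hs : 0 < 1 / (t : ℝ) := one_div_pos.2 ht0
  have h := ENNReal.toReal_mono (trace_rpow_lt_top (add_mem_logCone hP hQ) hs).ne
    (τ.trace_rpow_add_le hP.1 hQ.1 hP.2.1 hQ.2.1 hs ((div_le_one ht0).2 ht))
  rw [ENNReal.toReal_add (trace_rpow_lt_top hP hs).ne (trace_rpow_lt_top hQ hs).ne] at h
  rw [zetaFun, zetaFun, zetaFun, ← mul_add]
  exact mul_le_mul_of_nonneg_left h hs.le

theorem zetaFun_sqrt_conj_le (hP : P ∈ τ.logCone) (hb : b ∈ N) (hb0 : 0 ≤ b) {r : ℝ} (hr : 0 ≤ r)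
    (hbr : b ≤ algebraMap ℝ (H →L[ℂ] H) r) {t : Set.Ioi (0 : ℝ)} (ht : (1 : ℝ) ≤ t) :
    τ.zetaFun (CFC.sqrt P * b * CFC.sqrt P) t ≤ r ^ (1 / (t : ℝ)) * τ.zetaFunConj b P t := by
  have ht0 : 0 < (t : ℝ) := t.2
  have hs : 0 < 1 / (t : ℝ) := one_div_pos.2 ht0
  have h_mem := TracialFunctional.sqrt_conj_mem (rpow_mem_traceFunctional_cone hP hs) hb hb0
  have h := ENNReal.toReal_mono (ENNReal.mul_ne_top ENNReal.ofReal_ne_top h_mem.2.2.ne)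
    (τ.trace_sqrt_conj_rpow_le hP.1 hP.2.1 hb hb0 hr hbr hs ((div_le_one ht0).2 ht))
  rw [ENNReal.toReal_mul, ENNReal.toReal_ofReal (by positivity)] at h
  rw [zetaFun, zetaFunConj, mul_left_comm]
  exact mul_le_mul_of_nonneg_left h hs.le

end ZetaFunctions

section ZetaFunctional

variable (γ : GeneralisedLimit) {P Q b : H →L[ℂ] H}

theorem eval_zetaFun_add (hP : P ∈ τ.logCone) (hQ : Q ∈ τ.logCone) :
    γ.eval (τ.zetaFun (P + Q)) = γ.eval (τ.zetaFun P) + γ.eval (τ.zetaFun Q) := by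
  have hP_mem := tailPart_zetaFun_mem hP
  have hQ_mem := tailPart_zetaFun_mem hQ
  have hPQ_mem := tailPart_zetaFun_mem (add_mem_logCone hP hQ)
  rw [← γ.eval_add hP_mem hQ_mem]
  exact le_antisymm
    (γ.eval_le_of_le_rpow_mul hPQ_mem (tailPart_add_mem hP_mem hQ_mem) two_ne_zero
      fun _ ht => zetaFun_add_le hP hQ ht)
    (γ.eval_mono (tailPart_add_mem hP_mem hQ_mem) hPQ_mem
      fun _ ht => zetaFun_add_zetaFun_le hP hQ ht)

variable (τ) in
/-- The zeta functional `ζ_γ`, as a tracial functional on the logarithmic cone. -/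
noncomputable def zetaFunctional : TracialFunctional N where
  cone := τ.logCone
  val P := γ.eval (τ.zetaFun P)
  mem_alg _ h := h.1
  nonneg _ h := h.2.1
  zero_mem := zero_mem_logCone
  add_mem _ hP _ hQ := add_mem_logCone hP hQ
  posPart_mem _ hP _ hX hXs hXP := posPart_mem_logCone hP hX hXs hXP
  swap_mem _ hX h := swap_mem_logCone hX h
  val_add _ hP _ hQ := eval_zetaFun_add γ hP hQ
  val_swap X hX _ := by
    congr 1
    ext t
    rw [zetaFun, zetaFun, τ.rpow_swap hX (one_div_pos.2 t.2)]

theorem eval_zetaFun_sqrt_conj_le (hP : P ∈ τ.logCone) (hb : b ∈ N) (hb0 : 0 ≤ b) {n : ℕ}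
    (hn : n ≠ 0) (hbn : b ≤ n) :
    γ.eval (τ.zetaFun (CFC.sqrt P * b * CFC.sqrt P)) ≤ γ.eval (τ.zetaFunConj b P) :=
  γ.eval_le_of_le_rpow_mul
    (tailPart_zetaFun_mem ((τ.zetaFunctional γ).sqrt_conj_mem hP hb hb0))
    (tailPart_zetaFunConj_mem hP hb hb0) (Nat.cast_ne_zero.2 hn) fun _ ht =>
      zetaFun_sqrt_conj_le hP hb hb0 n.cast_nonneg (by rwa [map_natCast]) ht.le

theorem eval_zetaFun_sqrt_conj_add_natCast_sub (hP : P ∈ τ.logCone) (hb : b ∈ N) (hb0 : 0 ≤ b)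
    {n : ℕ} (hbn : b ≤ n) :
    γ.eval (τ.zetaFun (CFC.sqrt P * b * CFC.sqrt P)) +
      γ.eval (τ.zetaFun (CFC.sqrt P * ((n : H →L[ℂ] H) - b) * CFC.sqrt P)) =
        n * γ.eval (τ.zetaFun P) := by
  have h_add := (τ.zetaFunctional γ).val_add _ (TracialFunctional.sqrt_conj_mem hP hb hb0) _
    (TracialFunctional.sqrt_conj_mem hP (sub_mem (natCast_mem N n) hb) (sub_nonneg.2 hbn))
  rw [← add_mul, ← mul_add, add_sub_cancel, ← nsmul_one, mul_smul_comm, mul_one, smul_mul_assoc,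
    CFC.sqrt_mul_sqrt_self P hP.2.1,
    TracialFunctional.val_nsmul (φ := τ.zetaFunctional γ) hP n, nsmul_one] at h_add
  exact h_add.symm

theorem eval_zetaFunConj (hP : P ∈ τ.logCone) (hb : b ∈ N) (hb0 : 0 ≤ b) :
    γ.eval (τ.zetaFunConj b P) = γ.eval (τ.zetaFun (CFC.sqrt P * b * CFC.sqrt P)) := by
  obtain ⟨m, hm⟩ := exists_nat_ge ‖b‖
  obtain ⟨n, hn, hmn⟩ : ∃ n : ℕ, n ≠ 0 ∧ m ≤ n := ⟨m + 1, m.succ_ne_zero, m.le_succ⟩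
  have hbn : b ≤ n :=
    (CStarAlgebra.norm_le_natCast_iff_of_nonneg b n).1 (hm.trans (Nat.cast_le.2 hmn))
  have hc : (n : H →L[ℂ] H) - b ∈ N := sub_mem (natCast_mem N n) hb
  have hc0 : 0 ≤ (n : H →L[ℂ] H) - b := sub_nonneg.2 hbn
  have h_sum : γ.eval (τ.zetaFunConj b P) + γ.eval (τ.zetaFunConj ((n : H →L[ℂ] H) - b) P) =
      n * γ.eval (τ.zetaFun P) := by
    rw [← γ.eval_add (tailPart_zetaFunConj_mem hP hb hb0) (tailPart_zetaFunConj_mem hP hc hc0),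
      ← γ.eval_const_mul _ (tailPart_zetaFun_mem hP)]
    simp only [zetaFunConj_add_natCast_sub hP hb hb0 hbn]
  -- The inequalities for `b` and for `n - b` add up to an equality, so both are equalities.
  linarith [eval_zetaFun_sqrt_conj_le γ hP hb hb0 hn hbn,
    eval_zetaFun_sqrt_conj_le γ hP hc hc0 hn (sub_le_self _ hb0),
    eval_zetaFun_sqrt_conj_add_natCast_sub γ hP hb hb0 hbn]

end ZetaFunctional

end FNSTrace

end Zeta

section ZetaTwisted

variable {H : Type*} [NormedAddCommGroup H] [InnerProductSpace ℂ H] [CompleteSpace H]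

namespace JordanForall

variable {p q : (H →L[ℂ] H) → Prop} {A : H →L[ℂ] H}

theorem mono (h : JordanForall p A) (hpq : ∀ P, p P → q P) : JordanForall q A :=
  ⟨hpq _ h.1, hpq _ h.2.1, hpq _ h.2.2.1, hpq _ h.2.2.2⟩

theorem jordanExtend_congr (h : JordanForall p A) {F G : (H →L[ℂ] H) → ℂ}
    (hFG : ∀ P, p P → F P = G P) : jordanExtend F A = jordanExtend G A := by
  unfold jordanExtend
  rw [hFG _ h.1, hFG _ h.2.1, hFG _ h.2.2.1, hFG _ h.2.2.2]

end JordanForall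

theorem jordanForall_mem_vonNeumann_and_nonneg {N : VonNeumannAlgebra H} {B : H →L[ℂ] H}
    (hB : B ∈ N) : JordanForall (fun b => b ∈ N ∧ 0 ≤ b) B :=
  ⟨⟨posPart_mem_vonNeumann (realPart_mem_vonNeumann hB), CFC.posPart_nonneg _⟩,
    ⟨negPart_mem_vonNeumann (realPart_mem_vonNeumann hB), CFC.negPart_nonneg _⟩,
    ⟨posPart_mem_vonNeumann (imaginaryPart_mem_vonNeumann hB), CFC.posPart_nonneg _⟩,
    ⟨negPart_mem_vonNeumann (imaginaryPart_mem_vonNeumann hB), CFC.negPart_nonneg _⟩⟩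

namespace FNSTrace

variable {N : VonNeumannAlgebra H} {τ : FNSTrace N} {A P B : H →L[ℂ] H}

theorem finite_rpow_mul (hP : P ∈ τ.logCone) (hB : B ∈ N) {s : ℝ} (hs : 0 < s) :
    τ.Finite (P ^ (1 + s) * B) :=
  (TracialFunctional.mul_mem_domain_of_mem_cone (rpow_mem_traceFunctional_cone hP hs) hB).2.mono
    fun _ h => h.2.2

theorem zetaFunTwisted_eq (hP : P ∈ τ.logCone) (hB : B ∈ N) (t : Set.Ioi (0 : ℝ)) :
    τ.zetaFunTwisted B P t = jordanExtend (fun b => (τ.zetaFunConj b P t : ℂ)) B := by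
  have h_ext : τ.ext (P ^ (1 + 1 / (t : ℝ)) * B) = jordanExtend (fun b =>
      ((τ.toFun (CFC.sqrt (P ^ (1 + 1 / (t : ℝ))) * b *
        CFC.sqrt (P ^ (1 + 1 / (t : ℝ))))).toReal : ℂ)) B :=
    TracialFunctional.ext_mul_of_mem_cone
      (rpow_mem_traceFunctional_cone hP (one_div_pos.2 t.2)) hB
  rw [zetaFunTwisted, h_ext, jordanExtend, jordanExtend]
  simp only [zetaFunConj]
  push_cast
  ring

theorem zetaFunTwisted_re (hP : P ∈ τ.logCone) (hB : B ∈ N) :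
    (fun t => (τ.zetaFunTwisted B P t).re) = fun t =>
      τ.zetaFunConj (ℜ B : H →L[ℂ] H)⁺ P t - τ.zetaFunConj (ℜ B : H →L[ℂ] H)⁻ P t := by
  ext t
  simp [zetaFunTwisted_eq hP hB, jordanExtend]

theorem zetaFunTwisted_im (hP : P ∈ τ.logCone) (hB : B ∈ N) :
    (fun t => (τ.zetaFunTwisted B P t).im) = fun t =>
      τ.zetaFunConj (ℑ B : H →L[ℂ] H)⁺ P t - τ.zetaFunConj (ℑ B : H →L[ℂ] H)⁻ P t := by
  ext t
  simp [zetaFunTwisted_eq hP hB, jordanExtend]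

theorem evalC_zetaFunTwisted (γ : GeneralisedLimit) (hP : P ∈ τ.logCone) (hB : B ∈ N) :
    γ.evalC (τ.zetaFunTwisted B P) = (τ.zetaFunctional γ).ext (P * B) := by
  have hparts := jordanForall_mem_vonNeumann_and_nonneg hB
  have h_mem : JordanForall (fun b => tailPart (τ.zetaFunConj b P) ∈ LInfty) B :=
    hparts.mono fun b hb => tailPart_zetaFunConj_mem hP hb.1 hb.2
  calc γ.evalC (τ.zetaFunTwisted B P)
      = jordanExtend (fun b => (γ.eval (τ.zetaFunConj b P) : ℂ)) B := by
        rw [GeneralisedLimit.evalC, zetaFunTwisted_re hP hB, zetaFunTwisted_im hP hB,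
          γ.eval_sub h_mem.1 h_mem.2.1, γ.eval_sub h_mem.2.2.1 h_mem.2.2.2, jordanExtend,
          Complex.ofReal_sub, Complex.ofReal_sub]
    _ = jordanExtend (fun b => (γ.eval (τ.zetaFun (CFC.sqrt P * b * CFC.sqrt P)) : ℂ)) B :=
        hparts.jordanExtend_congr fun b hb => by rw [eval_zetaFunConj γ hP hb.1 hb.2]
    _ = (τ.zetaFunctional γ).ext (P * B) :=
        (TracialFunctional.ext_mul_of_mem_cone (φ := τ.zetaFunctional γ) hP hB).symm

theorem zetaTwistedDefined_of_mem_M1Infty (hA : A ∈ τ.M1Infty) (hB : B ∈ N) :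
    τ.ZetaTwistedDefined B A := by
  refine (jordanForall_mem_logCone hA).mono fun P hP => ?_
  have h_mem : JordanForall (fun b => tailPart (τ.zetaFunConj b P) ∈ LInfty) B :=
    (jordanForall_mem_vonNeumann_and_nonneg hB).mono fun b hb =>
      tailPart_zetaFunConj_mem hP hb.1 hb.2
  rw [zetaFunTwisted_re hP hB, zetaFunTwisted_im hP hB]
  exact ⟨fun t => finite_rpow_mul hP hB (one_div_pos.2 t.2),
    tailPart_sub_mem h_mem.1 h_mem.2.1, tailPart_sub_mem h_mem.2.2.1 h_mem.2.2.2⟩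

theorem zetaDefined_of_mem_M1Infty (hA : A ∈ τ.M1Infty) : τ.ZetaDefined A :=
  (jordanForall_mem_logCone hA).mono fun _ hP =>
    ⟨fun t => trace_rpow_lt_top hP (one_div_pos.2 t.2), tailPart_zetaFun_mem hP⟩

theorem zetaTwisted_eq_zeta_mul (γ : GeneralisedLimit) (hA : A ∈ τ.M1Infty) (hB : B ∈ N) :
    τ.zetaTwisted γ B A = τ.zeta γ (A * B) := by
  have h_parts := jordanForall_mem_logCone hA
  calc τ.zetaTwisted γ B A
      = jordanExtend (fun P => (τ.zetaFunctional γ).ext (P * B)) A :=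
        h_parts.jordanExtend_congr fun P hP => evalC_zetaFunTwisted γ hP hB
    _ = τ.zeta γ (A * B) :=
        (TracialFunctional.ext_mul (φ := τ.zetaFunctional γ) ⟨hA.1, h_parts⟩ hB).symm

end FNSTrace

end ZetaTwisted

theorem mainTheorem2 {H : Type*} [NormedAddCommGroup H] [InnerProductSpace ℂ H] [CompleteSpace H]
    (N : VonNeumannAlgebra H) (τ : FNSTrace N) (γ : GeneralisedLimit)
    (A B : H →L[ℂ] H) (hA : A ∈ τ.M1Infty) (hB : B ∈ N) :
    τ.ZetaTwistedDefined B A ∧ A * B ∈ τ.M1Infty ∧ τ.ZetaDefined (A * B) ∧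
      τ.zetaTwisted γ B A = τ.zeta γ (A * B) := by
  have hAB : A * B ∈ τ.M1Infty := FNSTrace.mul_mem_M1Infty hA hB
  exact ⟨FNSTrace.zetaTwistedDefined_of_mem_M1Infty hA hB, hAB,
    FNSTrace.zetaDefined_of_mem_M1Infty hAB, FNSTrace.zetaTwisted_eq_zeta_mul γ hA hB⟩
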